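/- **Definitions.** A *differentiator generating function* (DGF) is a locally absolutely continuous odd function $\Phi:\mathbb R\to\mathbb R$ such that $\Phi$ and $\Phi'$ are continuously differentiable on $\mathbb R\setminus\{0\}$, $\Phi'(x)>0$ for $x\neq 0$, $\lim_{x\to0}|\Phi'(x)|=\infty$ and $\lim_{x\to 0}\left|\frac{2\Phi'(x)^3}{\Phi''(x)}\right|=1$. It is *admissible* if there are constants $B>0$, $C>0$, $D\ge 1$ with $$\int_0^\infty\frac{dx}{B\,\Phi(x)}\le 1,\qquad C\,\Phi'(x)\ge 1 \ \text{ and }\ 2D|\Phi'(x)|^3\ge|\Phi''(x)|\ \text{ for all }x\ne 0.$$ A triple $\mathbf k=(k_1,k_2,k_3)$ of positive reals is *normalized* with respect to an admissible DGF $\Phi$ if, for some $D\ge1$ as in the definition of admissibility, $\overline L\ge 1$, where $$\overline L=\begin{cases}\dfrac{k_2}{D}&\text{if }k_1^2\ge 8k_2,\\[2mm] \dfrac{k_2}{D}\tanh\dfrac{\pi k_1}{2\sqrt{8k_2-k_1^2}}&\text{if }k_1^2<8k_2.\end{cases}$$ For a DGF $\Phi$ and $\mathbf k\in\mathbb R_{>0}^3$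 put $\nu_1(x)=k_3^{-1}\Phi(k_3^2x)$ and $\nu_2(x)=2\Phi(k_3^2x)\Phi'(k_3^2x)$. The differentiator $\dot y_1=k_1\nu_1(f-y_1)+y_2$, $\dot y_2=k_2\nu_2(f-y_1)$ with input $f$ and output $y_2$ has, in the error variables $x_1=f-y_1$, $x_2=\dot f-y_2$, the error dynamics $$\dot x_1=-k_1\nu_1(x_1)+x_2,\qquad \dot x_2=-k_2\nu_2(x_1)+\ddot f,$$ whose solutions on $[0,\infty)$ are understood in the sense of Filippov. For $L\ge 0$ the admitted signals are the continuously differentiable $f:[0,\infty)\to\mathbb R$ with $\dot f$ globally Lipschitz continuous with constant $L$ (i.e. $|\ddot f|\le L$ almost everywhere). The convergence time of a solution $\mathbf x$ is $\inf\{t\ge0:\mathbf x(\sigma)=0\ \text{for all }\sigma\ge t\}\in[0,\infty]$, with $\inf\emptyset=\infty$. The *global convergence time* $\overline T(\Phi,\mathbf k,L)\in[0,\infty]$ is the supremum of the convergence times over all initial states $\mathbf x(0)\in\mathbb R^2$, all admitted signals $f$, and all corresponding solutions. **Theorem (Tuning).** Let $L\ge 0$ and $T>0$. Let $\Phi$ be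 an admissible DGF, let $\tilde{\mathbf k}=(\tilde k_1,\tilde k_2,\tilde k_3)\in\mathbb R_{>0}^3$ be a normalized parameter triple with respect to $\Phi$, and suppose that $\overline T(\Phi,\tilde{\mathbf k},0)\le\tilde T$ for some $\tilde T>0$. For some $\gamma>L$ define $\mathbf k=(k_1,k_2,k_3)$ by $$k_1=\tilde k_1\sqrt\gamma,\qquad k_2=\tilde k_2\,\gamma,\qquad k_3=\frac{\tilde k_3\sqrt\gamma}{\gamma-L}\cdot\frac{\tilde T}{T}.$$ Then $\overline T(\Phi,\mathbf k,L)\le T$. -/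

import Mathlib

open Set Filter Topology MeasureTheory
open scoped ENNReal

noncomputable section

namespace RobustDiff

/-- Differentiator generating functions: locally absolutely continuous and with the five
defining properties. The derivatives are only ever evaluated away from the origin. -/
structure IsDGF (Φ : ℝ → ℝ) : Prop where
  locallyAC : ∀ a b : ℝ, AbsolutelyContinuousOnInterval Φ a b
  odd : ∀ x : ℝ, Φ (-x) = -Φ x
  contDiff : ContDiffOn ℝ 1 Φ {0}ᶜ
  contDiff_deriv : ContDiffOn ℝ 1 (deriv Φ) {0}ᶜ
  deriv_pos : ∀ x : ℝ, x ≠ 0 → 0 < deriv Φ x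
  tendsto_deriv : Tendsto (fun x => |deriv Φ x|) (𝓝[≠] 0) atTop
  tendsto_ratio :
    Tendsto (fun x => |2 * deriv Φ x ^ 3 / deriv (deriv Φ) x|) (𝓝[≠] 0) (𝓝 1)

/-- `Φ` is an admissible differentiator generating function with constants `B`, `C`, `D`.
The integral is the Lebesgue integral of a nonnegative function, so the bound includes
convergence. -/
structure IsAdmissibleWith (Φ : ℝ → ℝ) (B C D : ℝ) : Prop where
  isDGF : IsDGF Φ
  B_pos : 0 < B
  C_pos : 0 < C
  one_le_D : 1 ≤ D
  lintegral_le : ∫⁻ x in Ioi (0 : ℝ), ENNReal.ofReal (1 / (B * Φ x)) ≤ 1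
  one_le_deriv : ∀ x : ℝ, x ≠ 0 → 1 ≤ C * deriv Φ x
  growth : ∀ x : ℝ, x ≠ 0 → |deriv (deriv Φ) x| ≤ 2 * D * |deriv Φ x| ^ 3

/-- Admissible differentiator generating functions. -/
def IsAdmissible (Φ : ℝ → ℝ) : Prop := ∃ B C D : ℝ, IsAdmissibleWith Φ B C D

/-- A parameter triple `(k₁, k₂, k₃)`. -/
structure Params where
  k₁ : ℝ
  k₂ : ℝ
  k₃ : ℝ

/-- All three parameters are positive. -/
structure Params.Pos (k : Params) : Prop where
  k₁_pos : 0 < k.k₁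
  k₂_pos : 0 < k.k₂
  k₃_pos : 0 < k.k₃

open Classical in
/-- The Lipschitz constant bound `L̄` belonging to the parameters `k` and the growth
constant `D`. -/
def lipschitzBound (k : Params) (D : ℝ) : ℝ :=
  if 8 * k.k₂ ≤ k.k₁ ^ 2 then k.k₂ / D
  else k.k₂ / D * Real.tanh (Real.pi * k.k₁ / (2 * √(8 * k.k₂ - k.k₁ ^ 2)))

/-- A positive parameter triple that is normalized with respect to `Φ`. -/
def IsNormalized (Φ : ℝ → ℝ) (k : Params) : Prop :=
  k.Pos ∧ ∃ B C D : ℝ, IsAdmissibleWith Φ B C D ∧ 1 ≤ lipschitzBound k D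

/-- The first injection term `ν₁(x) = k₃⁻¹ Φ(k₃² x)`. -/
def nu₁ (Φ : ℝ → ℝ) (k : Params) (x : ℝ) : ℝ := k.k₃⁻¹ * Φ (k.k₃ ^ 2 * x)

/-- The second injection term `ν₂(x) = 2 Φ(k₃² x) Φ'(k₃² x)`; its value at `x = 0` does not
affect the Filippov solutions below. -/
def nu₂ (Φ : ℝ → ℝ) (k : Params) (x : ℝ) : ℝ :=
  2 * Φ (k.k₃ ^ 2 * x) * deriv Φ (k.k₃ ^ 2 * x)

/-- Signals on `[0, ∞)`: continuously differentiable, the derivative being Lipschitz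
continuous with constant `L`, that is `|f''| ≤ L` almost everywhere. Values of `f` on the
negative half-line play no role. -/
structure IsSignal (L : ℝ) (f : ℝ → ℝ) : Prop where
  contDiff : ContDiffOn ℝ 1 f (Ici 0)
  lipschitz : ∀ s t : ℝ, 0 ≤ s → 0 ≤ t →
    |derivWithin f (Ici 0) s - derivWithin f (Ici 0) t| ≤ L * |s - t|

/-- The second derivative of a signal on `[0, ∞)` (it exists at almost every time). -/
def secondDeriv (f : ℝ → ℝ) (t : ℝ) : ℝ := deriv (derivWithin f (Ici 0)) t

/-- Right-hand side of the differentiator's error dynamics, for the error variables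
`x = (f - y₁, f' - y₂)`, at time `t`. -/
def errorField (Φ : ℝ → ℝ) (k : Params) (f : ℝ → ℝ) (t : ℝ) (x : ℝ × ℝ) : ℝ × ℝ :=
  (-k.k₁ * nu₁ Φ k x.1 + x.2, -k.k₂ * nu₂ Φ k x.1 + secondDeriv f t)

/-- Filippov's set-valued regularization of a vector field on the plane. -/
def filippov (v : ℝ × ℝ → ℝ × ℝ) (x : ℝ × ℝ) : Set (ℝ × ℝ) :=
  ⋂ (δ : ℝ) (_ : 0 < δ) (N : Set (ℝ × ℝ)) (_ : volume N = 0),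
    closure (convexHull ℝ (v '' (Metric.ball x δ \ N)))

/-- `x` is a Filippov solution on `[0, ∞)` of the error dynamics with signal `f`. -/
structure IsErrorSolution (Φ : ℝ → ℝ) (k : Params) (f : ℝ → ℝ) (x : ℝ → ℝ × ℝ) : Prop where
  locallyAC : ∀ b : ℝ, 0 ≤ b → AbsolutelyContinuousOnInterval x 0 b
  inclusion : ∀ᵐ t ∂(volume.restrict (Ici (0 : ℝ))),
    ∃ w ∈ filippov (errorField Φ k f t) (x t), HasDerivAt x w t

/-- Infimum of the times from which on the trajectory rests at the origin; `∞` if there is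
none. -/
def settlingTime (x : ℝ → ℝ × ℝ) : ℝ≥0∞ :=
  sInf {τ | ∃ t : ℝ, 0 ≤ t ∧ (∀ σ : ℝ, t ≤ σ → x σ = 0) ∧ τ = ENNReal.ofReal t}

/-- `τ(x₀, f)`: the time that solutions with initial error `x₀` and signal `f` take to
converge to the origin (the worst case, should the solution not be unique). -/
def convergenceTime (Φ : ℝ → ℝ) (k : Params) (x₀ : ℝ × ℝ) (f : ℝ → ℝ) : ℝ≥0∞ :=
  ⨆ (x : ℝ → ℝ × ℝ) (_ : IsErrorSolution Φ k f x) (_ : x 0 = x₀), settlingTime x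

/-- The convergence time function: worst case over all signals with constant `L`. -/
def convergenceTimeFunction (Φ : ℝ → ℝ) (k : Params) (L : ℝ) (x₀ : ℝ × ℝ) : ℝ≥0∞ :=
  ⨆ (f : ℝ → ℝ) (_ : IsSignal L f), convergenceTime Φ k x₀ f

/-- The differentiator's global convergence time. -/
def globalConvergenceTime (Φ : ℝ → ℝ) (k : Params) (L : ℝ) : ℝ≥0∞ :=
  ⨆ x₀ : ℝ × ℝ, convergenceTimeFunction Φ k L x₀

end RobustDiff

end

/-!
# Tuning of a differentiator with prescribed convergence time

Write `k'` for the normalized parameters and `k` for the tuned ones. In the coordinates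
`z = (Φ(k₃² x₁), k₃ x₂ / √γ)`, and in a new time in which physical time passes at the rate
`g(z₁) / (k₃ √γ)` with `g(z₁) = 1 / Φ'(Φ⁻¹(z₁))`, the error dynamics without signal is the linear
system `z₁' = -k₁' z₁ + z₂`, `z₂' = -2 k₂' z₁`. Its settling time is therefore, up to a constant
factor, the integral `V` of `g(z₁)` along the linear trajectory (`settlingIntegral`). The growth
condition `|Φ''| ≤ 2 D Φ'³` says that `g` is Lipschitz with constant `2 D`
(`IsAdmissibleWith.exists_inverse`), so that `V` is Lipschitz in `z₂` with constant `2 D ∫ |h|`,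
where `h` is the impulse response of the linear system. The quantity `L̄` of the normalization is
the inverse of this constant (`exists_impulseResponse`), hence `V` is Lipschitz in `z₂` with
constant one. A signal with `|f''| ≤ L` acts on the second equation as a perturbation of relative
size at most `L / γ`, and so `V` still decreases at least at the rate `k₃ √γ (1 - L / γ)` in
physical time (`deriv_settlingIntegral_le`, `lyapunov_le_of_ne_zero`).

The function `V / k₃'` is bounded by the convergence time of the differentiator with the parameters
`k'`, because the linear trajectories, run in physical time, really are Filippov solutions which do
not settle earlier (`settlingIntegral_le_of_globalConvergenceTime_le`). The value of `k₃` is the one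
for which the guaranteed decay of `V` during the time `T` equals the resulting bound on `V`.
-/

noncomputable section

namespace RobustDiff

/-! ### The linear system -/

/-- `h` is the impulse response of `y'' + a y' + b y = 0`, and `h'` its derivative. -/
structure IsImpulseResponse (a b : ℝ) (h h' : ℝ → ℝ) : Prop where
  hasDerivAt : ∀ s, HasDerivAt h (h' s) s
  hasDerivAt' : ∀ s, HasDerivAt h' (-a * h' s - b * h s) s
  zero : h 0 = 0
  zero' : h' 0 = 1

/-- `(y, w)` solves the linear system `y' = -a y + w`, `w' = -b y`. -/
structure IsLinearFlow (a b : ℝ) (y w : ℝ → ℝ) : Prop where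
  fst : ∀ s, HasDerivAt y (-a * y s + w s) s
  snd : ∀ s, HasDerivAt w (-b * y s) s

theorem integrableOn_of_exp_decay {u : ℝ → ℝ} (hu : Continuous u) {K c : ℝ}
    (hc : 0 < c) (hK : ∀ s, 0 ≤ s → |u s| ≤ K * Real.exp (-c * s)) : IntegrableOn u (Ioi 0) := by
  refine Integrable.mono' (((exp_neg_integrableOn_Ioi 0 hc)).const_mul K)
    hu.aestronglyMeasurable ?_
  filter_upwards [ae_restrict_mem measurableSet_Ioi] with s hs
  exact hK s (le_of_lt hs)

theorem tendsto_of_exp_decay {u : ℝ → ℝ} {K c : ℝ}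
    (hc : 0 < c) (hK : ∀ s, 0 ≤ s → |u s| ≤ K * Real.exp (-c * s)) : Tendsto u atTop (𝓝 0) := by
  have h1 : Tendsto (fun s : ℝ => K * Real.exp (-c * s)) atTop (𝓝 (K * 0)) := by
    refine Tendsto.const_mul _ (Real.tendsto_exp_atBot.comp ?_)
    exact (tendsto_const_mul_atBot_of_neg (neg_neg_of_pos hc)).2 tendsto_id
  rw [mul_zero] at h1
  refine squeeze_zero_norm' ?_ h1
  filter_upwards [eventually_ge_atTop 0] with s hs using hK s hs

namespace IsImpulseResponse

variable {a b : ℝ} {h h' : ℝ → ℝ}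

theorem continuous (H : IsImpulseResponse a b h h') : Continuous h :=
  continuous_iff_continuousAt.2 fun s => (H.hasDerivAt s).continuousAt

theorem continuous' (H : IsImpulseResponse a b h h') : Continuous h' :=
  continuous_iff_continuousAt.2 fun s => (H.hasDerivAt' s).continuousAt

/-- Exponential decay, from the quadratic Lyapunov function
`(h' + a h)² + h'² + 2 b h²`, whose derivative is `-2 a (b h² + h'²)`. -/
theorem exists_decay (H : IsImpulseResponse a b h h') (ha : 0 < a) (hb : 0 < b) :
    ∃ K c : ℝ, 0 < c ∧ ∀ s, 0 ≤ s →
      |h s| ≤ K * Real.exp (-c * s) ∧ |h' s| ≤ K * Real.exp (-c * s) := by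
  set E : ℝ → ℝ := fun s => (h' s + a * h s) ^ 2 + h' s ^ 2 + 2 * b * h s ^ 2 with hE
  -- `m` dominates the Lyapunov function relative to its decay rate.
  set m : ℝ := 3 + (2 * a ^ 2 + 2 * b) / b with hm
  have hm0 : 0 < m := by positivity
  set c : ℝ := a / m with hc
  have hc0 : 0 < c := by positivity
  have hEd : ∀ s, HasDerivAt E (-2 * a * (b * h s ^ 2 + h' s ^ 2)) s := by
    intro s
    have h1 := H.hasDerivAt s
    have h2 := H.hasDerivAt' s
    have := (((h2.add (h1.const_mul a)).pow 2).add (h2.pow 2)).add ((h1.pow 2).const_mul (2 * b))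
    refine this.congr_deriv ?_
    simp only [Pi.add_apply]
    push_cast
    ring
  have hEm : ∀ s, E s ≤ m * (b * h s ^ 2 + h' s ^ 2) := by
    intro s
    have e : m * (b * h s ^ 2 + h' s ^ 2)
        = (3 * b + 2 * a ^ 2 + 2 * b) * h s ^ 2 + m * h' s ^ 2 := by
      rw [hm]; field_simp; ring
    have e2 : 3 * h' s ^ 2 ≤ m * h' s ^ 2 := by
      have : 0 ≤ (2 * a ^ 2 + 2 * b) / b := by positivity
      exact mul_le_mul_of_nonneg_right (by linarith) (sq_nonneg _)
    rw [e]
    simp only [hE]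
    nlinarith [sq_nonneg (h' s - a * h s), mul_nonneg hb.le (sq_nonneg (h s))]
  have hanti : Antitone fun s => E s * Real.exp (2 * c * s) := by
    have hd : ∀ s, HasDerivAt (fun s => E s * Real.exp (2 * c * s))
        (-2 * a * (b * h s ^ 2 + h' s ^ 2) * Real.exp (2 * c * s)
          + E s * (Real.exp (2 * c * s) * (2 * c))) s := by
      intro s
      refine (hEd s).mul ?_
      have : HasDerivAt (fun s : ℝ => 2 * c * s) (2 * c) s := by
        simpa using (hasDerivAt_id s).const_mul (2 * c)
      exact this.exp
    refine antitone_of_deriv_nonpos (fun s => (hd s).differentiableAt) fun s => ?_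
    rw [(hd s).deriv]
    have h3 : c * E s ≤ a * (b * h s ^ 2 + h' s ^ 2) := by
      calc c * E s ≤ c * (m * (b * h s ^ 2 + h' s ^ 2)) :=
            mul_le_mul_of_nonneg_left (hEm s) hc0.le
        _ = a * (b * h s ^ 2 + h' s ^ 2) := by rw [hc]; field_simp
    have h4 := Real.exp_pos (2 * c * s)
    nlinarith
  have hE0 : E 0 = 2 := by simp [hE, H.zero, H.zero']; norm_num
  have hEle : ∀ s, 0 ≤ s → E s ≤ 2 * Real.exp (-c * s) ^ 2 := by
    intro s hs
    have h5 := hanti hs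
    simp only [hE0, mul_zero, Real.exp_zero, mul_one] at h5
    have h6 : Real.exp (2 * c * s) * Real.exp (-c * s) ^ 2 = 1 := by
      rw [sq, ← Real.exp_add, ← Real.exp_add]; simp; ring
    calc E s = E s * Real.exp (2 * c * s) * Real.exp (-c * s) ^ 2 := by
          rw [mul_assoc, h6, mul_one]
      _ ≤ _ := mul_le_mul_of_nonneg_right h5 (sq_nonneg _)
  refine ⟨2 + 1 / b, c, hc0, fun s hs => ?_⟩
  have hx := Real.exp_pos (-c * s)
  have h7 := hEle s hs
  simp only [hE] at h7
  have hb' : 0 < 1 / b := by positivity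
  constructor
  · apply abs_le_of_sq_le_sq _ (by positivity)
    have h8 : b * h s ^ 2 ≤ Real.exp (-c * s) ^ 2 := by
      nlinarith [sq_nonneg (h' s + a * h s), sq_nonneg (h' s)]
    have h9 : h s ^ 2 ≤ 1 / b * Real.exp (-c * s) ^ 2 := by
      rw [one_div, inv_mul_eq_div, le_div_iff₀ hb]; linarith
    rw [mul_pow]
    refine h9.trans (mul_le_mul_of_nonneg_right ?_ (sq_nonneg _))
    nlinarith
  · apply abs_le_of_sq_le_sq _ (by positivity)
    have h8 : h' s ^ 2 ≤ 2 * Real.exp (-c * s) ^ 2 := by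
      nlinarith [sq_nonneg (h' s + a * h s), mul_nonneg hb.le (sq_nonneg (h s))]
    rw [mul_pow]
    refine h8.trans (mul_le_mul_of_nonneg_right ?_ (sq_nonneg _))
    nlinarith

theorem integrableOn (H : IsImpulseResponse a b h h') (ha : 0 < a) (hb : 0 < b) :
    IntegrableOn h (Ioi 0) := by
  obtain ⟨K, c, hc, hK⟩ := H.exists_decay ha hb
  exact integrableOn_of_exp_decay H.continuous hc fun s hs => (hK s hs).1

theorem integrableOn' (H : IsImpulseResponse a b h h') (ha : 0 < a) (hb : 0 < b) :
    IntegrableOn h' (Ioi 0) := by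
  obtain ⟨K, c, hc, hK⟩ := H.exists_decay ha hb
  exact integrableOn_of_exp_decay H.continuous' hc fun s hs => (hK s hs).2

theorem tendsto (H : IsImpulseResponse a b h h') (ha : 0 < a) (hb : 0 < b) :
    Tendsto h atTop (𝓝 0) := by
  obtain ⟨K, c, hc, hK⟩ := H.exists_decay ha hb
  exact tendsto_of_exp_decay hc fun s hs => (hK s hs).1

theorem tendsto' (H : IsImpulseResponse a b h h') (ha : 0 < a) (hb : 0 < b) :
    Tendsto h' atTop (𝓝 0) := by
  obtain ⟨K, c, hc, hK⟩ := H.exists_decay ha hb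
  exact tendsto_of_exp_decay hc fun s hs => (hK s hs).2

/-- Every initial state `(p, q)` starts a trajectory of the linear system, in terms of the
impulse response. -/
theorem isLinearFlow (H : IsImpulseResponse a b h h') (p q : ℝ) :
    IsLinearFlow a b (fun s => p * h' s + q * h s)
      (fun s => -b * p * h s + q * (h' s + a * h s)) where
  fst s := by
    refine (((H.hasDerivAt' s).const_mul p).add ((H.hasDerivAt s).const_mul q)).congr_deriv ?_
    ring
  snd s := by
    refine (((H.hasDerivAt s).const_mul (-b * p)).add
      (((H.hasDerivAt' s).add ((H.hasDerivAt s).const_mul a)).const_mul q)).congr_deriv ?_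
    ring

/-- Variation of constants: a trajectory of the linear system is determined by its state at any
time `r`. The function `τ ↦ h'(s + r - τ) y(τ) + h(s + r - τ) w(τ)` is constant. -/
theorem flow_add (H : IsImpulseResponse a b h h') {y w : ℝ → ℝ} (F : IsLinearFlow a b y w)
    (s r : ℝ) : y (s + r) = y r * h' s + w r * h s := by
  have hd : ∀ τ, HasDerivAt (fun τ => h' (s + r - τ) * y τ + h (s + r - τ) * w τ) 0 τ := by
    intro τ
    have hi : HasDerivAt (fun τ : ℝ => s + r - τ) (-1) τ := by
      simpa using (hasDerivAt_id τ).const_sub (s + r)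
    have h1 := (H.hasDerivAt (s + r - τ)).comp τ hi
    have h2 := (H.hasDerivAt' (s + r - τ)).comp τ hi
    refine ((h2.mul (F.fst τ)).add (h1.mul (F.snd τ))).congr_deriv ?_
    simp only [Function.comp_apply]
    ring
  have hc := is_const_of_deriv_eq_zero (fun τ => (hd τ).differentiableAt)
    (fun τ => (hd τ).deriv) (s + r) r
  simp only [sub_self, H.zero, H.zero', add_sub_cancel_right] at hc
  linarith

/-- A trajectory of the linear system through the origin is identically zero. -/
theorem flow_eq_zero (H : IsImpulseResponse a b h h') {y w : ℝ → ℝ} (F : IsLinearFlow a b y w)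
    {r : ℝ} (hy : y r = 0) (hw : w r = 0) (t : ℝ) : y t = 0 ∧ w t = 0 := by
  have h0 : y = fun _ => 0 := by
    funext t
    have := H.flow_add F (t - r) r
    simpa [hy, hw] using this
  have h1 := F.fst t
  rw [h0] at h1
  have h2 := h1.unique (hasDerivAt_const t (0 : ℝ))
  exact ⟨congrFun h0 t, by simpa using h2⟩

end IsImpulseResponse

theorem IsLinearFlow.continuous_fst {a b : ℝ} {y w : ℝ → ℝ} (F : IsLinearFlow a b y w) :
    Continuous y := continuous_iff_continuousAt.2 fun s => (F.fst s).continuousAt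

theorem IsLinearFlow.continuous_snd {a b : ℝ} {y w : ℝ → ℝ} (F : IsLinearFlow a b y w) :
    Continuous w := continuous_iff_continuousAt.2 fun s => (F.snd s).continuousAt

/-! ### The integral of the impulse response -/

theorem integral_Ioi_comp_add (u : ℝ → ℝ) (r : ℝ) :
    ∫ s in Ioi 0, u (s + r) = ∫ s in Ioi r, u s := by
  have h := (measurePreserving_add_right volume r).setIntegral_preimage_emb
    (measurableEmbedding_addRight r) u (Ioi r)
  rwa [preimage_add_const_Ioi, sub_self] at h

namespace IsImpulseResponse

variable {a b : ℝ} {h h' : ℝ → ℝ}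

/-- The impulse response as a damped solution `S` of `S'' = (a² / 4 - b) S`. -/
theorem of_damped {S S' : ℝ → ℝ} (hS : ∀ s, HasDerivAt S (S' s) s)
    (hS' : ∀ s, HasDerivAt S' ((a ^ 2 / 4 - b) * S s) s) (h0 : S 0 = 0) (h0' : S' 0 = 1) :
    IsImpulseResponse a b (fun s => Real.exp (-(a / 2) * s) * S s)
      (fun s => Real.exp (-(a / 2) * s) * (S' s - a / 2 * S s)) := by
  have he : ∀ s : ℝ, HasDerivAt (fun s => Real.exp (-(a / 2) * s))
      (Real.exp (-(a / 2) * s) * (-(a / 2))) s := by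
    intro s
    have : HasDerivAt (fun s : ℝ => -(a / 2) * s) (-(a / 2)) s := by
      simpa using (hasDerivAt_id s).const_mul (-(a / 2))
    exact this.exp
  refine ⟨fun s => ?_, fun s => ?_, by simp [h0], by simp [h0, h0']⟩
  · refine ((he s).mul (hS s)).congr_deriv ?_
    ring
  · refine ((he s).mul ((hS' s).sub ((hS s).const_mul (a / 2)))).congr_deriv ?_
    simp only [Pi.sub_apply]
    ring

/-- The function `-(h' + a h) / b` is an antiderivative of `h`. -/
theorem hasDerivAt_primitive (H : IsImpulseResponse a b h h') (hb : b ≠ 0) (s : ℝ) :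
    HasDerivAt (fun s => -(h' s + a * h s) / b) (h s) s := by
  refine (((H.hasDerivAt' s).add ((H.hasDerivAt s).const_mul a)).neg.div_const b).congr_deriv ?_
  field_simp
  ring

/-- Without oscillation, the impulse response is nonnegative and has integral `1 / b`. -/
theorem exists_overdamped (ha : 0 < a) (hb : 0 < b) (hab : 4 * b ≤ a ^ 2) :
    ∃ h h', IsImpulseResponse a b h h' ∧ ∫ s in Ioi 0, |h s| = 1 / b := by
  obtain ⟨S, S', hS, hS', h0, h0', hpos⟩ : ∃ S S' : ℝ → ℝ, (∀ s, HasDerivAt S (S' s) s) ∧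
      (∀ s, HasDerivAt S' ((a ^ 2 / 4 - b) * S s) s) ∧ S 0 = 0 ∧ S' 0 = 1 ∧
      ∀ s, 0 ≤ s → 0 ≤ S s := by
    rcases hab.eq_or_lt with heq | hlt
    · refine ⟨fun s => s, fun _ => 1, fun s => hasDerivAt_id s, fun s => ?_, rfl, rfl,
        fun s hs => hs⟩
      have : a ^ 2 / 4 - b = 0 := by linarith
      rw [this, zero_mul]
      exact hasDerivAt_const s 1
    · set r := √(a ^ 2 / 4 - b) with hr
      have hr0 : 0 < r := Real.sqrt_pos.2 (by linarith)
      have hr2 : r ^ 2 = a ^ 2 / 4 - b := Real.sq_sqrt (by linarith)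
      have hi : ∀ s : ℝ, HasDerivAt (fun s : ℝ => r * s) r s := fun s => by
        simpa using (hasDerivAt_id s).const_mul r
      refine ⟨fun s => Real.sinh (r * s) / r, fun s => Real.cosh (r * s), fun s => ?_,
        fun s => ?_, by simp, by simp, fun s hs => ?_⟩
      · refine ((hi s).sinh.div_const r).congr_deriv ?_
        field_simp
      · refine ((hi s).cosh).congr_deriv ?_
        rw [← hr2]
        field_simp
      · exact div_nonneg (Real.sinh_nonneg_iff.2 (by positivity)) hr0.le
  have H := of_damped hS hS' h0 h0'
  refine ⟨_, _, H, ?_⟩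
  have habs : ∫ s in Ioi (0 : ℝ), |Real.exp (-(a / 2) * s) * S s|
      = ∫ s in Ioi (0 : ℝ), Real.exp (-(a / 2) * s) * S s := by
    refine setIntegral_congr_fun measurableSet_Ioi fun s hs => ?_
    exact abs_of_nonneg (mul_nonneg (Real.exp_pos _).le (hpos s (le_of_lt hs)))
  have hlim : Tendsto (fun s => -(Real.exp (-(a / 2) * s) * (S' s - a / 2 * S s)
      + a * (Real.exp (-(a / 2) * s) * S s)) / b) atTop (𝓝 (-(0 + a * 0) / b)) :=
    ((H.tendsto' ha hb).add ((H.tendsto ha hb).const_mul a)).neg.div_const b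
  rw [habs, integral_Ioi_of_hasDerivAt_of_tendsto' (fun s _ => H.hasDerivAt_primitive hb.ne' s)
    (H.integrableOn ha hb) hlim]
  simp only [H.zero, H.zero']
  ring

/-- In the oscillating case, `|h|` decreases by the factor `q = exp (-a π / (2 ω))` over each
half-period `π / ω`, so that its integral is a geometric series with value
`(1 + q) / (b (1 - q)) = 1 / (b tanh (a π / (4 ω)))`. -/
theorem exists_underdamped (ha : 0 < a) (hb : 0 < b) (hab : a ^ 2 < 4 * b) :
    ∃ h h', IsImpulseResponse a b h h' ∧
      b * Real.tanh (Real.pi * a / (2 * √(4 * b - a ^ 2))) * ∫ s in Ioi 0, |h s| = 1 := by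
  set ω := √(4 * b - a ^ 2) / 2 with hω
  have hω0 : 0 < ω := by
    have : 0 < √(4 * b - a ^ 2) := Real.sqrt_pos.2 (by linarith)
    positivity
  have hω2 : ω ^ 2 = b - a ^ 2 / 4 := by
    rw [hω, div_pow, Real.sq_sqrt (by linarith)]; ring
  have hi : ∀ s : ℝ, HasDerivAt (fun s : ℝ => ω * s) ω s := fun s => by
    simpa using (hasDerivAt_id s).const_mul ω
  have H : IsImpulseResponse a b (fun s => Real.exp (-(a / 2) * s) * (Real.sin (ω * s) / ω))
      (fun s => Real.exp (-(a / 2) * s) * (Real.cos (ω * s) - a / 2 * (Real.sin (ω * s) / ω))) := by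
    refine of_damped (S' := fun s => Real.cos (ω * s)) (fun s => ?_) (fun s => ?_)
      (by simp) (by simp)
    · refine ((hi s).sin.div_const ω).congr_deriv ?_
      field_simp
    · refine ((hi s).cos).congr_deriv ?_
      have : a ^ 2 / 4 - b = -ω ^ 2 := by rw [hω2]; ring
      rw [this]
      field_simp
  refine ⟨_, _, H, ?_⟩
  set h : ℝ → ℝ := fun s => Real.exp (-(a / 2) * s) * (Real.sin (ω * s) / ω) with hh
  set P := Real.pi / ω with hP
  have hP0 : 0 < P := div_pos Real.pi_pos hω0
  have hωP : ω * P = Real.pi := by rw [hP]; field_simp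
  set q := Real.exp (-(a / 2) * P) with hq
  have hq1 : q < 1 := by
    rw [hq, Real.exp_lt_one_iff]
    have : 0 < a / 2 * P := by positivity
    linarith
  have hshift : ∀ s, |h (s + P)| = q * |h s| := by
    intro s
    have e1 : h (s + P) = -(q * h s) := by
      simp only [hh, hq]
      rw [mul_add, mul_add, hωP, Real.sin_add_pi, Real.exp_add]
      ring
    rw [e1, abs_neg, abs_mul, abs_of_pos (Real.exp_pos _)]
  have hint : IntegrableOn (fun s => |h s|) (Ioi 0) := (H.integrableOn ha hb).norm
  have hsplit : ∫ s in Ioi 0, |h s| = (∫ s in (0 : ℝ)..P, |h s|) + ∫ s in Ioi P, |h s| := by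
    rw [intervalIntegral.integral_interval_add_Ioi hint
      (hint.mono_set (Ioi_subset_Ioi hP0.le))]
  have htail : ∫ s in Ioi P, |h s| = q * ∫ s in Ioi 0, |h s| := by
    rw [← integral_Ioi_comp_add (fun s => |h s|) P, ← integral_const_mul]
    simp only [hshift]
  have hfirst : ∫ s in (0 : ℝ)..P, |h s| = (1 + q) / b := by
    have e1 : ∫ s in (0 : ℝ)..P, |h s| = ∫ s in (0 : ℝ)..P, h s := by
      refine intervalIntegral.integral_congr fun s hs => ?_
      rw [uIcc_of_le hP0.le] at hs
      refine abs_of_nonneg (mul_nonneg (Real.exp_pos _).le (div_nonneg ?_ hω0.le))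
      refine Real.sin_nonneg_of_nonneg_of_le_pi (mul_nonneg hω0.le hs.1) ?_
      rw [← hωP]
      exact mul_le_mul_of_nonneg_left hs.2 hω0.le
    rw [e1, intervalIntegral.integral_eq_sub_of_hasDerivAt
      (fun s _ => H.hasDerivAt_primitive hb.ne' s) (H.continuous.intervalIntegrable _ _)]
    simp only [hωP, hh, mul_zero, Real.exp_zero, Real.sin_zero, Real.cos_zero, Real.sin_pi,
      Real.cos_pi, zero_div, ← hq]
    field_simp
    ring
  have hI : (1 - q) * ∫ s in Ioi 0, |h s| = (1 + q) / b := by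
    rw [htail, hfirst] at hsplit
    linarith
  have hth : Real.tanh (Real.pi * a / (2 * √(4 * b - a ^ 2))) * (1 + q) = 1 - q := by
    have hx : Real.pi * a / (2 * √(4 * b - a ^ 2)) = a * P / 4 := by
      have h2 : √(4 * b - a ^ 2) = 2 * ω := by rw [hω]; ring
      rw [h2, hP]
      field_simp
      ring
    have hqe : q = Real.exp (-(a * P / 4)) * Real.exp (-(a * P / 4)) := by
      rw [hq, ← Real.exp_add]; congr 1; ring
    rw [hx, Real.tanh_eq_sinh_div_cosh, Real.sinh_eq, Real.cosh_eq, hqe]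
    have h3 : Real.exp (a * P / 4) * Real.exp (-(a * P / 4)) = 1 := by
      rw [← Real.exp_add]; simp
    have h4 := Real.exp_pos (a * P / 4)
    have h5 := Real.exp_pos (-(a * P / 4))
    generalize Real.exp (a * P / 4) = u at *
    generalize Real.exp (-(a * P / 4)) = v at *
    have h6 : u + v ≠ 0 := by positivity
    field_simp
    linear_combination (2 * v) * h3
  have hq1' : (1 : ℝ) - q ≠ 0 := by linarith
  have hI' : ∫ s in Ioi 0, |h s| = (1 + q) / b / (1 - q) := by
    rw [← hI]; field_simp
  rw [hI']
  have : b * Real.tanh (Real.pi * a / (2 * √(4 * b - a ^ 2))) * ((1 + q) / b / (1 - q))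
      = Real.tanh (Real.pi * a / (2 * √(4 * b - a ^ 2))) * (1 + q) / (1 - q) := by
    field_simp
  rw [this, hth, div_self hq1']

end IsImpulseResponse

/-- The meaning of the bound `L̄`: its inverse is `2 D` times the `L¹` norm of the impulse response
of the linear system with coefficients `k₁` and `2 k₂`. -/
theorem exists_impulseResponse {k : Params} (hk : k.Pos) {D : ℝ} (hD : 0 < D)
    (hL : 1 ≤ lipschitzBound k D) :
    ∃ h h', IsImpulseResponse k.k₁ (2 * k.k₂) h h' ∧ 2 * D * ∫ s in Ioi 0, |h s| ≤ 1 := by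
  have hk₁ := hk.k₁_pos
  have hk₂ := hk.k₂_pos
  unfold lipschitzBound at hL
  split_ifs at hL with hc
  · obtain ⟨h, h', H, hI⟩ := IsImpulseResponse.exists_overdamped hk₁
      (b := 2 * k.k₂) (by positivity) (by linarith)
    refine ⟨h, h', H, ?_⟩
    rw [le_div_iff₀ hD] at hL
    rw [hI, mul_one_div, div_le_one (by positivity)]
    linarith
  · obtain ⟨h, h', H, hI⟩ := IsImpulseResponse.exists_underdamped hk₁
      (b := 2 * k.k₂) (by positivity) (by linarith)
    refine ⟨h, h', H, ?_⟩
    have e : 4 * (2 * k.k₂) - k.k₁ ^ 2 = 8 * k.k₂ - k.k₁ ^ 2 := by ring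
    rw [e] at hI
    set θ := Real.tanh (Real.pi * k.k₁ / (2 * √(8 * k.k₂ - k.k₁ ^ 2)))
    have h0 : 0 ≤ ∫ s in Ioi 0, |h s| := integral_nonneg fun s => abs_nonneg _
    have h1 : D ≤ k.k₂ * θ := by
      rw [div_mul_eq_mul_div, le_div_iff₀ hD] at hL
      linarith
    calc 2 * D * ∫ s in Ioi 0, |h s| ≤ 2 * (k.k₂ * θ) * ∫ s in Ioi 0, |h s| := by gcongr
      _ = 1 := by rw [← hI]; ring

/-! ### The inverse of a differentiator generating function -/

namespace IsDGF

variable {Φ : ℝ → ℝ}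

theorem continuous (H : IsDGF Φ) : Continuous Φ := by
  refine continuous_iff_continuousAt.2 fun x => ?_
  have h1 := (H.locallyAC (x - 1) (x + 1)).continuousOn
  rw [uIcc_of_le (by linarith)] at h1
  exact h1.continuousAt (Icc_mem_nhds (by linarith) (by linarith))

theorem zero (H : IsDGF Φ) : Φ 0 = 0 := by
  have := H.odd 0
  rw [neg_zero] at this
  linarith

theorem hasDerivAt (H : IsDGF Φ) {x : ℝ} (hx : x ≠ 0) : HasDerivAt Φ (deriv Φ x) x :=
  (differentiableAt_of_deriv_ne_zero (H.deriv_pos x hx).ne').hasDerivAt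

theorem hasDerivAt_deriv (H : IsDGF Φ) {x : ℝ} (hx : x ≠ 0) :
    HasDerivAt (deriv Φ) (deriv (deriv Φ) x) x :=
  ((H.contDiff_deriv.contDiffAt (isOpen_compl_singleton.mem_nhds hx)).differentiableAt
    (by norm_num)).hasDerivAt

theorem deriv_neg' (H : IsDGF Φ) (x : ℝ) : deriv Φ (-x) = deriv Φ x := by
  have h1 : deriv (fun y => Φ (-y)) x = deriv (fun y => -Φ y) x := by
    congr 1; funext y; exact H.odd y
  rw [deriv_comp_neg, deriv.fun_neg] at h1
  linarith

theorem strictMono (H : IsDGF Φ) : StrictMono Φ := by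
  refine strictMono_of_odd_strictMonoOn_nonneg H.odd ?_
  refine strictMonoOn_of_deriv_pos (convex_Ici 0) H.continuous.continuousOn fun x hx => ?_
  rw [interior_Ici] at hx
  exact H.deriv_pos x (ne_of_gt hx)

end IsDGF

/-- Data of the inverse `Ψ` of a differentiator generating function `Φ`: its derivative `g`
(which is `1 / Φ' ∘ Ψ` and vanishes at the origin), as far as needed here. -/
structure IsInverseDGF (Φ Ψ g : ℝ → ℝ) (D : ℝ) : Prop where
  left_inv : ∀ x, Ψ (Φ x) = x
  right_inv : ∀ z, Φ (Ψ z) = z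
  hasDerivAt : ∀ z, HasDerivAt Ψ (g z) z
  inv_deriv : ∀ z, z ≠ 0 → deriv Φ (Ψ z) = (g z)⁻¹
  zero : g 0 = 0
  pos : ∀ z, z ≠ 0 → 0 < g z
  lipschitz : ∀ z w, |g z - g w| ≤ 2 * D * |z - w|
  exists_lower : ∀ R, ∃ c, 0 < c ∧ ∀ z, |z| ≤ R → c * |z| ≤ g z

namespace IsAdmissibleWith

variable {Φ : ℝ → ℝ} {B C D : ℝ}

theorem surjective (H : IsAdmissibleWith Φ B C D) : Function.Surjective Φ := by
  have hle : ∀ x, 0 ≤ x → C⁻¹ * x ≤ Φ x := by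
    intro x hx
    have hmono : MonotoneOn (fun x => Φ x - C⁻¹ * x) (Ici 0) := by
      have hd : ∀ x : ℝ, x ≠ 0 → HasDerivAt (fun x => Φ x - C⁻¹ * x) (deriv Φ x - C⁻¹) x := by
        intro x hx
        have : HasDerivAt (fun x : ℝ => C⁻¹ * x) C⁻¹ x := by
          simpa using (hasDerivAt_id x).const_mul C⁻¹
        exact (H.isDGF.hasDerivAt hx).sub this
      refine monotoneOn_of_deriv_nonneg (convex_Ici 0)
        (H.isDGF.continuous.sub (by fun_prop)).continuousOn ?_ ?_
      · intro x hx
        rw [interior_Ici] at hx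
        exact (hd x (ne_of_gt hx)).differentiableAt.differentiableWithinAt
      · intro x hx
        rw [interior_Ici] at hx
        rw [(hd x (ne_of_gt hx)).deriv, sub_nonneg, inv_le_iff_one_le_mul₀' H.C_pos]
        exact H.one_le_deriv x (ne_of_gt hx)
    have := hmono self_mem_Ici hx hx
    simp only [H.isDGF.zero, mul_zero, sub_zero] at this
    linarith
  have htop : Tendsto Φ atTop atTop := by
    refine tendsto_atTop_mono' atTop ?_
      (tendsto_id.const_mul_atTop (inv_pos.2 H.C_pos))
    filter_upwards [eventually_ge_atTop 0] with x hx using hle x hx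
  refine H.isDGF.continuous.surjective htop ?_
  have h2 : Φ = fun x => -Φ (-x) := by funext x; rw [H.isDGF.odd]; simp
  rw [h2]
  exact tendsto_neg_atTop_atBot.comp (htop.comp tendsto_neg_atBot_atTop)

/-- The inverse of an admissible function is continuously differentiable, and its derivative is
Lipschitz with constant `2 D`, because `(1 / Φ')' / Φ' = -Φ'' / Φ'³`. -/
theorem exists_inverse (H : IsAdmissibleWith Φ B C D) : ∃ Ψ g, IsInverseDGF Φ Ψ g D := by
  have Hd := H.isDGF
  set e := Hd.strictMono.orderIsoOfSurjective Φ H.surjective with he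
  have heΦ : ∀ x, e x = Φ x := fun x => rfl
  let Ψ : ℝ → ℝ := fun z => e.symm z
  have hl : ∀ x, Ψ (Φ x) = x := fun x => e.symm_apply_apply x
  have hr : ∀ z, Φ (Ψ z) = z := fun z => e.apply_symm_apply z
  have hΨc : Continuous Ψ := e.symm.continuous
  have hΨ0 : Ψ 0 = 0 := by rw [← Hd.zero, hl, Hd.zero]
  have hΨne : ∀ z, z ≠ 0 → Ψ z ≠ 0 := by
    intro z hz h0
    apply hz
    rw [← hr z, h0, Hd.zero]
  have hΨneg : ∀ z, Ψ (-z) = -Ψ z := by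
    intro z
    apply Hd.strictMono.injective
    rw [hr, Hd.odd, hr]
  set g : ℝ → ℝ := fun z => if z = 0 then 0 else (deriv Φ (Ψ z))⁻¹ with hg
  have hg0 : g 0 = 0 := by simp [hg]
  have hgne : ∀ z, z ≠ 0 → g z = (deriv Φ (Ψ z))⁻¹ := fun z hz => by simp [hg, hz]
  have hgpos : ∀ z, z ≠ 0 → 0 < g z := fun z hz => by
    rw [hgne z hz]; exact inv_pos.2 (Hd.deriv_pos _ (hΨne z hz))
  have hgeven : ∀ z, g (-z) = g z := by
    intro z
    rcases eq_or_ne z 0 with rfl | hz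
    · simp
    · rw [hgne _ (neg_ne_zero.2 hz), hgne _ hz, hΨneg, Hd.deriv_neg']
  have hgabs : ∀ z, g |z| = g z := by
    intro z
    rcases abs_choice z with h | h <;> rw [h]
    exact hgeven z
  have hΨd : ∀ z, z ≠ 0 → HasDerivAt Ψ (g z) z := by
    intro z hz
    rw [hgne z hz]
    exact HasDerivAt.of_local_left_inverse hΨc.continuousAt
      (Hd.hasDerivAt (hΨne z hz)) (Hd.deriv_pos _ (hΨne z hz)).ne'
      (Eventually.of_forall hr)
  have hgd : ∀ z, z ≠ 0 →
      HasDerivAt g (-(deriv (deriv Φ) (Ψ z) / deriv Φ (Ψ z) ^ 3)) z := by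
    intro z hz
    have hp := (Hd.deriv_pos _ (hΨne z hz)).ne'
    have h1 := ((Hd.hasDerivAt_deriv (hΨne z hz)).comp z (hΨd z hz)).inv hp
    have h2 : g =ᶠ[𝓝 z] (deriv Φ ∘ Ψ)⁻¹ := by
      filter_upwards [isOpen_compl_singleton.mem_nhds hz] with y hy
      simpa using hgne y hy
    refine (h1.congr_of_eventuallyEq h2).congr_deriv ?_
    rw [hgne z hz]
    simp only [Function.comp_apply]
    field_simp
  have hgt0 : ContinuousAt g 0 := by
    rw [continuousAt_iff_punctured_nhds, hg0]
    have h1 : Tendsto Ψ (𝓝[≠] 0) (𝓝[≠] 0) := by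
      refine tendsto_nhdsWithin_iff.2 ⟨?_, ?_⟩
      · have := hΨc.tendsto 0
        rw [hΨ0] at this
        exact this.mono_left nhdsWithin_le_nhds
      · filter_upwards [self_mem_nhdsWithin] with z hz using hΨne z hz
    have h2 := tendsto_inv_atTop_zero.comp (Hd.tendsto_deriv.comp h1)
    refine h2.congr' ?_
    filter_upwards [self_mem_nhdsWithin] with z hz
    simp only [Function.comp_apply]
    rw [hgne z hz, abs_of_pos (Hd.deriv_pos _ (hΨne z hz))]
  have hgc : Continuous g := by
    refine continuous_iff_continuousAt.2 fun z => ?_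
    rcases eq_or_ne z 0 with rfl | hz
    · exact hgt0
    · exact (hgd z hz).continuousAt
  have hLip : ∀ z w, 0 ≤ z → z ≤ w → |g w - g z| ≤ 2 * D * (w - z) := by
    intro z w hz hzw
    rcases hzw.eq_or_lt with rfl | hlt
    · simp
    have hmv : ∃ c ∈ Ioo z w, -(deriv (deriv Φ) (Ψ c) / deriv Φ (Ψ c) ^ 3)
        = (g w - g z) / (w - z) :=
      exists_hasDerivAt_eq_slope g _ hlt hgc.continuousOn fun x hx =>
        hgd x (ne_of_gt (lt_of_le_of_lt hz hx.1))
    obtain ⟨c, hc, hce⟩ := hmv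
    have hc0 : c ≠ 0 := ne_of_gt (lt_of_le_of_lt hz hc.1)
    have hp := Hd.deriv_pos _ (hΨne c hc0)
    have h3 : |(g w - g z) / (w - z)| ≤ 2 * D := by
      rw [← hce, abs_neg, abs_div, abs_pow, div_le_iff₀ (by positivity)]
      exact H.growth _ (hΨne c hc0)
    rw [abs_div, abs_of_pos (sub_pos.2 hlt), div_le_iff₀ (sub_pos.2 hlt)] at h3
    exact h3
  have hD : 0 ≤ 2 * D := by have := H.one_le_D; linarith
  refine ⟨Ψ, g, hl, hr, ?_, ?_, hg0, hgpos, ?_, ?_⟩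
  · intro z
    rcases eq_or_ne z 0 with rfl | hz
    · exact hasDerivAt_of_hasDerivAt_of_ne' hΨd hΨc.continuousAt hgt0 0
    · exact hΨd z hz
  · intro z hz
    rw [hgne z hz, inv_inv]
  · intro z w
    rw [← hgabs z, ← hgabs w]
    refine le_trans ?_ (mul_le_mul_of_nonneg_left (abs_abs_sub_abs_le_abs_sub z w) hD)
    rcases le_total |z| |w| with h | h
    · rw [abs_sub_comm, abs_sub_comm |z|, abs_of_nonneg (sub_nonneg.2 h)]
      exact hLip _ _ (abs_nonneg _) h
    · rw [abs_of_nonneg (sub_nonneg.2 h)]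
      exact hLip _ _ (abs_nonneg _) h
  · intro R
    -- Near the origin the limit of `2 Φ'³ / Φ''` bounds the slope of `g` from below.
    have hev : ∀ᶠ x in 𝓝[≠] (0 : ℝ), |2 * deriv Φ x ^ 3 / deriv (deriv Φ) x| < 2 ∧
        0 < |2 * deriv Φ x ^ 3 / deriv (deriv Φ) x| :=
      (Hd.tendsto_ratio.eventually (gt_mem_nhds (by norm_num))).and
        (Hd.tendsto_ratio.eventually (lt_mem_nhds (by norm_num)))
    have hevz : ∀ᶠ z in 𝓝[≠] (0 : ℝ), 1 ≤ |deriv (deriv Φ) (Ψ z) / deriv Φ (Ψ z) ^ 3| := by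
      have h1 : Tendsto Ψ (𝓝[≠] 0) (𝓝[≠] 0) := by
        refine tendsto_nhdsWithin_iff.2 ⟨?_, ?_⟩
        · have := hΨc.tendsto 0
          rw [hΨ0] at this
          exact this.mono_left nhdsWithin_le_nhds
        · filter_upwards [self_mem_nhdsWithin] with z hz using hΨne z hz
      filter_upwards [h1.eventually hev, self_mem_nhdsWithin] with z hz hzne
      have hp := Hd.deriv_pos _ (hΨne z hzne)
      have hq : deriv (deriv Φ) (Ψ z) ≠ 0 := by
        intro h0
        rw [h0] at hz
        simp at hz
      have hq' : 0 < |deriv (deriv Φ) (Ψ z)| := abs_pos.2 hq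
      rw [abs_div, abs_of_pos (by positivity : 0 < deriv Φ (Ψ z) ^ 3), le_div_iff₀ (by positivity)]
      have h2 := hz.1
      rw [abs_div, abs_of_pos (by positivity : 0 < 2 * deriv Φ (Ψ z) ^ 3), div_lt_iff₀ hq'] at h2
      linarith
    rw [eventually_nhdsWithin_iff, Metric.eventually_nhds_iff] at hevz
    obtain ⟨η, hη, hηz⟩ := hevz
    have hsmall : ∀ z, 0 ≤ z → z < η → z ≤ g z := by
      intro z hz hzη
      rcases hz.eq_or_lt with rfl | hlt
      · exact hg0.ge
      obtain ⟨c, hc, hce⟩ := exists_hasDerivAt_eq_slope g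
        (fun z => -(deriv (deriv Φ) (Ψ z) / deriv Φ (Ψ z) ^ 3)) hlt
        hgc.continuousOn fun x hx => hgd x (ne_of_gt hx.1)
      have h3 : 1 ≤ |g z / z| := by
        rw [hg0, sub_zero, sub_zero] at hce
        rw [← hce, abs_neg]
        exact hηz (by rw [dist_zero_right, Real.norm_eq_abs, abs_of_pos hc.1]
                      exact hc.2.trans hzη) (ne_of_gt hc.1)
      rw [abs_of_pos (div_pos (hgpos z hlt.ne') hlt), le_div_iff₀ hlt] at h3
      linarith
    -- Away from the origin, on a compact interval, `g` has a positive minimum.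
    obtain ⟨m, hm, hmz⟩ : ∃ m, 0 < m ∧ ∀ z ∈ Icc η (max R η), m ≤ g z := by
      obtain ⟨z₀, hz₀, hmin⟩ := (isCompact_Icc (a := η) (b := max R η)).exists_isMinOn
        ⟨η, le_rfl, le_max_right _ _⟩ hgc.continuousOn
      exact ⟨g z₀, hgpos _ (ne_of_gt (lt_of_lt_of_le hη hz₀.1)), fun z hz => hmin hz⟩
    have hM : 0 < max R η := lt_of_lt_of_le hη (le_max_right _ _)
    refine ⟨min 1 (m / max R η), lt_min one_pos (div_pos hm hM), fun z hz => ?_⟩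
    rw [← hgabs z]
    rcases lt_or_ge |z| η with h | h
    · calc _ ≤ 1 * |z| := mul_le_mul_of_nonneg_right (min_le_left _ _) (abs_nonneg _)
        _ ≤ _ := by rw [one_mul]; exact hsmall _ (abs_nonneg _) h
    · calc _ ≤ m / max R η * |z| :=
            mul_le_mul_of_nonneg_right (min_le_right _ _) (abs_nonneg _)
        _ ≤ m / max R η * max R η := by gcongr; exact hz.trans (le_max_left _ _)
        _ = m := by field_simp
        _ ≤ _ := hmz _ ⟨h, hz.trans (le_max_left _ _)⟩

end IsAdmissibleWith

namespace IsInverseDGF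

variable {Φ Ψ g : ℝ → ℝ} {D : ℝ}

theorem nonneg (G : IsInverseDGF Φ Ψ g D) (z : ℝ) : 0 ≤ g z := by
  rcases eq_or_ne z 0 with rfl | hz
  · exact G.zero.ge
  · exact (G.pos z hz).le

theorem le_abs (G : IsInverseDGF Φ Ψ g D) (z : ℝ) : g z ≤ 2 * D * |z| := by
  have := G.lipschitz z 0
  rw [G.zero, sub_zero, sub_zero, abs_of_nonneg (G.nonneg z)] at this
  exact this

theorem nonneg_const (G : IsInverseDGF Φ Ψ g D) : 0 ≤ 2 * D := by
  have := (abs_nonneg _).trans (G.lipschitz 1 0)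
  simpa using this

theorem continuous (G : IsInverseDGF Φ Ψ g D) : Continuous g := by
  have : LipschitzWith (Real.toNNReal (2 * D)) g := by
    refine LipschitzWith.of_dist_le_mul fun z w => ?_
    rw [Real.coe_toNNReal _ G.nonneg_const]
    exact G.lipschitz z w
  exact this.continuous

end IsInverseDGF

section

/-! ### The settling time of the unperturbed system as a function of the state -/

/-- The time which the unperturbed differentiator with `k₃ = 1` needs to settle from the error with
`Φ x₁ = p` and `x₂ = q`: physical time passes at the rate `g` along the trajectory of the linear
system through `(p, q)`, whose impulse response is `h`, with derivative `h'`. -/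
def settlingIntegral (g h h' : ℝ → ℝ) (p q : ℝ) : ℝ := ∫ s in Ioi 0, g (p * h' s + q * h s)

variable {Φ Ψ g h h' : ℝ → ℝ} {a b D : ℝ}

theorem settlingIntegral_nonneg (G : IsInverseDGF Φ Ψ g D) (p q : ℝ) :
    0 ≤ settlingIntegral g h h' p q := integral_nonneg fun _ => G.nonneg _

theorem settlingIntegral_zero (G : IsInverseDGF Φ Ψ g D) : settlingIntegral g h h' 0 0 = 0 := by
  simp [settlingIntegral, G.zero]

theorem IsInverseDGF.integrableOn_comp (G : IsInverseDGF Φ Ψ g D) {u : ℝ → ℝ} (hu : Continuous u)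
    (hi : IntegrableOn u (Ioi 0)) : IntegrableOn (fun s => g (u s)) (Ioi 0) := by
  refine Integrable.mono' (hi.abs.const_mul (2 * D))
    (G.continuous.comp hu).aestronglyMeasurable (ae_of_all _ fun s => ?_)
  rw [Real.norm_eq_abs, abs_of_nonneg (G.nonneg _)]
  exact G.le_abs _

theorem IsImpulseResponse.integrableOn_comb (H : IsImpulseResponse a b h h') (ha : 0 < a)
    (hb : 0 < b) (p q : ℝ) : IntegrableOn (fun s => p * h' s + q * h s) (Ioi 0) :=
  ((H.integrableOn' ha hb).const_mul p).add ((H.integrableOn ha hb).const_mul q)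

/-- The settling time is Lipschitz in the state, with constant `1` in the second variable. -/
theorem abs_settlingIntegral_sub_le (H : IsImpulseResponse a b h h') (ha : 0 < a) (hb : 0 < b)
    (G : IsInverseDGF Φ Ψ g D) (hI : 2 * D * ∫ s in Ioi 0, |h s| ≤ 1) (p q p' q' : ℝ) :
    |settlingIntegral g h h' p q - settlingIntegral g h h' p' q'| ≤
      (2 * D * ∫ s in Ioi 0, |h' s|) * |p - p'| + |q - q'| := by
  have hi := fun p q => G.integrableOn_comp (H.isLinearFlow p q).continuous_fst
    (H.integrableOn_comb ha hb p q)
  have h1 : IntegrableOn (fun s => |h s|) (Ioi 0) := (H.integrableOn ha hb).abs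
  have h2 : IntegrableOn (fun s => |h' s|) (Ioi 0) := (H.integrableOn' ha hb).abs
  unfold settlingIntegral
  rw [← integral_sub (hi p q) (hi p' q')]
  calc |∫ s in Ioi 0, (g (p * h' s + q * h s) - g (p' * h' s + q' * h s))|
      ≤ ∫ s in Ioi 0, (2 * D * |p - p'| * |h' s| + 2 * D * |q - q'| * |h s|) := by
        refine (abs_integral_le_integral_abs).trans ?_
        refine integral_mono ((hi p q).sub (hi p' q')).abs
          ((h2.const_mul _).add (h1.const_mul _)) fun s => ?_
        refine (G.lipschitz _ _).trans ?_
        have e : p * h' s + q * h s - (p' * h' s + q' * h s)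
            = (p - p') * h' s + (q - q') * h s := by ring
        rw [e]
        have h3 := abs_add_le ((p - p') * h' s) ((q - q') * h s)
        rw [abs_mul, abs_mul] at h3
        have := mul_le_mul_of_nonneg_left h3 G.nonneg_const
        linarith
    _ = (2 * D * ∫ s in Ioi 0, |h' s|) * |p - p'|
          + (2 * D * ∫ s in Ioi 0, |h s|) * |q - q'| := by
        rw [integral_add (h2.const_mul _) (h1.const_mul _), integral_const_mul,
          integral_const_mul]
        ring
    _ ≤ _ := by
        have := mul_le_mul_of_nonneg_right hI (abs_nonneg (q - q'))
        linarith

theorem continuous_settlingIntegral (H : IsImpulseResponse a b h h') (ha : 0 < a) (hb : 0 < b)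
    (G : IsInverseDGF Φ Ψ g D) (hI : 2 * D * ∫ s in Ioi 0, |h s| ≤ 1) :
    Continuous fun z : ℝ × ℝ => settlingIntegral g h h' z.1 z.2 := by
  refine continuous_iff_continuousAt.2 fun z => ?_
  have hc : Tendsto (fun y : ℝ × ℝ => (2 * D * ∫ s in Ioi 0, |h' s|) * |y.1 - z.1| + |y.2 - z.2|)
      (𝓝 z) (𝓝 ((2 * D * ∫ s in Ioi 0, |h' s|) * |z.1 - z.1| + |z.2 - z.2|)) :=
    Continuous.tendsto (by fun_prop) z
  simp only [sub_self, abs_zero, mul_zero, add_zero] at hc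
  rw [ContinuousAt, tendsto_iff_dist_tendsto_zero]
  exact squeeze_zero (fun _ => dist_nonneg)
    (fun y => abs_settlingIntegral_sub_le H ha hb G hI _ _ _ _) hc

/-- Along the linear flow, the settling time decreases by the time passed. -/
theorem settlingIntegral_flow (H : IsImpulseResponse a b h h') (ha : 0 < a) (hb : 0 < b)
    (G : IsInverseDGF Φ Ψ g D) {y w : ℝ → ℝ} (F : IsLinearFlow a b y w) (r : ℝ) :
    settlingIntegral g h h' (y r) (w r)
      = settlingIntegral g h h' (y 0) (w 0) - ∫ s in (0 : ℝ)..r, g (y s) := by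
  have hy : y = fun s => y 0 * h' s + w 0 * h s := by
    funext s
    have := H.flow_add F s 0
    rwa [add_zero] at this
  have hi : IntegrableOn (fun s => g (y s)) (Ioi 0) := by
    refine G.integrableOn_comp F.continuous_fst ?_
    rw [hy]
    exact H.integrableOn_comb ha hb _ _
  have hcont : Continuous fun s => g (y s) := G.continuous.comp F.continuous_fst
  have hir : IntegrableOn (fun s => g (y s)) (Ioi r) := by
    rcases le_total 0 r with hr | hr
    · exact hi.mono_set (Ioi_subset_Ioi hr)
    · rw [← Ioc_union_Ioi_eq_Ioi hr]
      exact hcont.integrableOn_Ioc.union hi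
  have e1 : settlingIntegral g h h' (y r) (w r) = ∫ s in Ioi r, g (y s) := by
    rw [← integral_Ioi_comp_add (fun s => g (y s)) r]
    unfold settlingIntegral
    simp only [H.flow_add F]
  have e2 : settlingIntegral g h h' (y 0) (w 0) = ∫ s in Ioi 0, g (y s) := by
    unfold settlingIntegral
    conv_rhs => rw [hy]
  rw [e1, e2, ← intervalIntegral.integral_interval_add_Ioi hi hir]
  ring

/-! ### Decay of the settling time under a perturbation -/

theorem hasDerivAt_abs_of_zero {e : ℝ → ℝ} {x : ℝ} (he : HasDerivAt e 0 x) (h0 : e x = 0) :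
    HasDerivAt (fun y => |e y|) 0 x := by
  rw [hasDerivAt_iff_isLittleO] at he ⊢
  simpa [h0] using he.norm_left

theorem nonneg_of_hasDerivAt_of_forall_gt {r : ℝ → ℝ} {r' x : ℝ} (hr : HasDerivAt r r' x)
    (h0 : ∀ y, x < y → r x ≤ r y) : 0 ≤ r' := by
  have h1 := (hasDerivAt_iff_tendsto_slope.1 hr).mono_left
    (nhdsWithin_mono x (fun y (hy : x < y) => ne_of_gt hy) : 𝓝[>] x ≤ 𝓝[≠] x)
  refine ge_of_tendsto h1 ?_
  filter_upwards [self_mem_nhdsWithin] with y hy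
  rw [slope_def_field]
  exact div_nonneg (sub_nonneg.2 (h0 y hy)) (sub_nonneg.2 (le_of_lt hy))

/-- Along a perturbed trajectory, in which the linear system runs at the speed `ρ / g` and the
second equation has a perturbation bounded by `ρ ℓ`, the settling time decreases at least at the
rate `ρ (1 - ℓ)`. No differentiability of the settling time in the state is needed: it is compared
with its values on the linear trajectory, the difference being controlled by the Lipschitz
bound. -/
theorem deriv_settlingIntegral_le (H : IsImpulseResponse a b h h') (ha : 0 < a) (hb : 0 < b)
    (G : IsInverseDGF Φ Ψ g D) (hI : 2 * D * ∫ s in Ioi 0, |h s| ≤ 1) {p q : ℝ → ℝ}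
    {t ρ v ℓ W' : ℝ} (hρ : 0 < ρ) (hp0 : p t ≠ 0)
    (hp : HasDerivAt p (ρ * (g (p t))⁻¹ * (-a * p t + q t)) t)
    (hq : HasDerivAt q (ρ * (g (p t))⁻¹ * (-b * p t) + ρ * v) t) (hv : |v| ≤ ℓ)
    (hW : HasDerivAt (fun s => settlingIntegral g h h' (p s) (q s)) W' t) :
    W' ≤ -(ρ * (1 - ℓ)) := by
  set V := settlingIntegral g h h' with hV
  set K := 2 * D * ∫ s in Ioi 0, |h' s| with hK
  set m := ρ * (g (p t))⁻¹ with hm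
  have hg := G.pos _ hp0
  set y : ℝ → ℝ := fun s => p t * h' s + q t * h s with hy
  set w : ℝ → ℝ := fun s => -b * p t * h s + q t * (h' s + a * h s) with hw
  have F : IsLinearFlow a b y w := H.isLinearFlow (p t) (q t)
  have hy0 : y 0 = p t := by simp [hy, H.zero, H.zero']
  have hw0 : w 0 = q t := by simp [hw, H.zero, H.zero']
  have hi : HasDerivAt (fun s : ℝ => m * (s - t)) m t := by
    simpa using ((hasDerivAt_id t).sub_const t).const_mul m
  have ht0 : m * (t - t) = 0 := by simp
  have hyd : HasDerivAt (fun s => y (m * (s - t))) (m * (-a * p t + q t)) t := by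
    have := HasDerivAt.comp t (h₂ := y) (F.fst (m * (t - t))) hi
    refine this.congr_deriv ?_
    rw [ht0, hy0, hw0]; ring
  have hwd : HasDerivAt (fun s => w (m * (s - t))) (m * (-b * p t)) t := by
    have := HasDerivAt.comp t (h₂ := w) (F.snd (m * (t - t))) hi
    refine this.congr_deriv ?_
    rw [ht0, hy0]; ring
  have hgy : Continuous fun s => g (y s) := G.continuous.comp F.continuous_fst
  have hVd : HasDerivAt (fun s => V (y (m * (s - t))) (w (m * (s - t)))) (-ρ) t := by
    have e : (fun s => V (y (m * (s - t))) (w (m * (s - t))))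
        = fun s => V (y 0) (w 0) - ∫ σ in (0 : ℝ)..(m * (s - t)), g (y σ) := by
      funext s
      exact settlingIntegral_flow H ha hb G F _
    rw [e]
    have h1 := HasDerivAt.comp t (h₂ := fun r => ∫ σ in (0 : ℝ)..r, g (y σ))
      (hgy.integral_hasStrictDerivAt 0 (m * (t - t))).hasDerivAt hi
    refine (h1.const_sub (V (y 0) (w 0))).congr_deriv ?_
    rw [ht0, hy0, hm]
    field_simp
  have hlin : ∀ c : ℝ, HasDerivAt (fun s : ℝ => c * (s - t)) c t := fun c => by
    simpa using ((hasDerivAt_id t).sub_const t).const_mul c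
  have he1 : HasDerivAt (fun s => |p s - y (m * (s - t))|) 0 t := by
    refine hasDerivAt_abs_of_zero ((hp.sub hyd).congr_deriv (by ring)) ?_
    simp [hy0]
  have he2 : HasDerivAt (fun s => |q s - w (m * (s - t)) - ρ * v * (s - t)|) 0 t := by
    refine hasDerivAt_abs_of_zero (((hq.sub hwd).sub (hlin (ρ * v))).congr_deriv (by ring)) ?_
    simp [hw0]
  have hr : HasDerivAt (fun s => V (y (m * (s - t))) (w (m * (s - t))) + ρ * ℓ * (s - t)
      + (K * |p s - y (m * (s - t))| + |q s - w (m * (s - t)) - ρ * v * (s - t)|)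
      - V (p s) (q s)) (-ρ + ρ * ℓ + (K * 0 + 0) - W') t :=
    ((hVd.add (hlin (ρ * ℓ))).add ((he1.const_mul K).add he2)).sub hW
  have := nonneg_of_hasDerivAt_of_forall_gt hr fun s hs => by
    simp only [sub_self, mul_zero, hy0, hw0, abs_zero, add_zero]
    have h1 := abs_settlingIntegral_sub_le H ha hb G hI (p s) (q s) (y (m * (s - t)))
      (w (m * (s - t)) + ρ * v * (s - t))
    have h2 := abs_settlingIntegral_sub_le H ha hb G hI (y (m * (s - t)))
      (w (m * (s - t)) + ρ * v * (s - t)) (y (m * (s - t))) (w (m * (s - t)))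
    rw [sub_self, abs_zero, mul_zero, zero_add, add_sub_cancel_left, abs_mul, abs_mul,
      abs_of_pos hρ, abs_of_pos (sub_pos.2 hs)] at h2
    have h3 : ρ * |v| * (s - t) ≤ ρ * ℓ * (s - t) := by
      have := sub_pos.2 hs
      gcongr
    have h4 := (le_abs_self _).trans h1
    have h5 := (le_abs_self _).trans h2
    simp only [← hV, ← hK] at h4 h5
    rw [sub_sub (q s)]
    linarith
  linarith

end

section

/-! ### The Filippov regularization -/

/-- Where a linear functional of the field is continuous, it is single-valued on the Filippov
set. -/
theorem apply_eq_of_mem_filippov {v : ℝ × ℝ → ℝ × ℝ} {x w : ℝ × ℝ} (l : ℝ × ℝ →L[ℝ] ℝ)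
    (hc : ContinuousAt (fun y => l (v y)) x) (hw : w ∈ filippov v x) : l w = l (v x) := by
  refine eq_of_forall_dist_le fun ε hε => ?_
  obtain ⟨δ, hδ, hb⟩ := Metric.continuousAt_iff.1 hc ε hε
  simp only [filippov, mem_iInter] at hw
  have h1 := hw δ hδ ∅ measure_empty
  have hcl : IsClosed (l ⁻¹' Metric.closedBall (l (v x)) ε) :=
    Metric.isClosed_closedBall.preimage l.continuous
  have hcv : Convex ℝ (l ⁻¹' Metric.closedBall (l (v x)) ε) :=
    (convex_closedBall (l (v x)) ε).linear_preimage l.toLinearMap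
  refine closure_minimal (convexHull_min ?_ hcv) hcl h1
  rintro _ ⟨y, hy, rfl⟩
  exact (hb hy.1).le

theorem fst_eq_of_mem_filippov {v : ℝ × ℝ → ℝ × ℝ} {x w : ℝ × ℝ}
    (hc : ContinuousAt (fun y => (v y).1) x) (hw : w ∈ filippov v x) : w.1 = (v x).1 :=
  apply_eq_of_mem_filippov (ContinuousLinearMap.fst ℝ ℝ ℝ) hc hw

theorem snd_eq_of_mem_filippov {v : ℝ × ℝ → ℝ × ℝ} {x w : ℝ × ℝ}
    (hc : ContinuousAt (fun y => (v y).2) x) (hw : w ∈ filippov v x) : w.2 = (v x).2 :=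
  apply_eq_of_mem_filippov (ContinuousLinearMap.snd ℝ ℝ ℝ) hc hw

theorem exists_mem_ball_notMem {x : ℝ × ℝ} {δ : ℝ} (hδ : 0 < δ) {N : Set (ℝ × ℝ)}
    (hN : volume N = 0) : ∃ y ∈ Metric.ball x δ, y ∉ N := by
  by_contra! hcon
  exact (Metric.measure_ball_pos volume x hδ).ne' (measure_mono_null hcon hN)

theorem mem_filippov_of_continuousAt {v : ℝ × ℝ → ℝ × ℝ} {x : ℝ × ℝ} (hc : ContinuousAt v x) :
    v x ∈ filippov v x := by
  simp only [filippov, mem_iInter]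
  intro δ hδ N hN
  refine closure_mono (subset_convexHull ℝ _) (Metric.mem_closure_iff.2 fun ε hε => ?_)
  obtain ⟨η, hη, hb⟩ := Metric.continuousAt_iff.1 hc ε hε
  obtain ⟨y, hy, hyN⟩ := exists_mem_ball_notMem (x := x) (lt_min hδ hη) hN
  refine ⟨v y, ⟨y, ⟨Metric.ball_subset_ball (min_le_left _ _) hy, hyN⟩, rfl⟩, ?_⟩
  rw [dist_comm]
  exact hb (Metric.ball_subset_ball (min_le_right _ _) hy)

/-- For an odd field, the origin is an equilibrium of the Filippov inclusion. -/
theorem zero_mem_filippov_zero {v : ℝ × ℝ → ℝ × ℝ} (hv : ∀ x, v (-x) = -v x) :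
    0 ∈ filippov v 0 := by
  simp only [filippov, mem_iInter]
  intro δ hδ N hN
  refine subset_closure ?_
  have hN' : volume (N ∪ -N) = 0 := measure_union_null hN (by rwa [Measure.measure_neg])
  obtain ⟨y, hy, hyN⟩ := exists_mem_ball_notMem (x := (0 : ℝ × ℝ)) hδ hN'
  rw [mem_union, not_or] at hyN
  have h1 : v y ∈ convexHull ℝ (v '' (Metric.ball 0 δ \ N)) :=
    subset_convexHull ℝ _ ⟨y, ⟨hy, hyN.1⟩, rfl⟩
  have h2 : v (-y) ∈ convexHull ℝ (v '' (Metric.ball 0 δ \ N)) := by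
    refine subset_convexHull ℝ _ ⟨-y, ⟨?_, fun h => hyN.2 (by simpa using h)⟩, rfl⟩
    simpa using hy
  have h3 := convex_convexHull ℝ (v '' (Metric.ball 0 δ \ N)) h1 h2
    (by norm_num : (0 : ℝ) ≤ 1 / 2) (by norm_num : (0 : ℝ) ≤ 1 / 2) (by norm_num)
  rwa [hv, smul_neg, add_neg_cancel] at h3

variable {Φ : ℝ → ℝ}

theorem IsDGF.continuous_errorField_fst (H : IsDGF Φ) (k : Params) (f : ℝ → ℝ) (t : ℝ) :
    Continuous fun x => (errorField Φ k f t x).1 := by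
  have := H.continuous
  unfold errorField nu₁
  fun_prop

theorem IsDGF.continuousAt_errorField (H : IsDGF Φ) {k : Params} (hk : k.k₃ ≠ 0) (f : ℝ → ℝ)
    (t : ℝ) {x : ℝ × ℝ} (hx : x.1 ≠ 0) : ContinuousAt (errorField Φ k f t) x := by
  refine ContinuousAt.prodMk (H.continuous_errorField_fst k f t).continuousAt ?_
  have h1 : ContinuousAt (fun x : ℝ × ℝ => k.k₃ ^ 2 * x.1) x := by fun_prop
  have h2 : ContinuousAt (fun x : ℝ × ℝ => deriv Φ (k.k₃ ^ 2 * x.1)) x :=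
    ContinuousAt.comp (g := deriv Φ) (H.hasDerivAt_deriv
      (mul_ne_zero (pow_ne_zero 2 hk) hx)).continuousAt h1
  have h3 : ContinuousAt (fun x : ℝ × ℝ => Φ (k.k₃ ^ 2 * x.1)) x :=
    ContinuousAt.comp (g := Φ) H.continuous.continuousAt h1
  exact (((h3.const_mul 2).mul h2).const_mul (-k.k₂)).add continuousAt_const

end

section

/-! ### The unperturbed trajectories as Filippov solutions -/

/-- The image of the critical points of a function on the line is a null set. -/
theorem volume_image_eq_zero_of_hasDerivAt_zero {τ : ℝ → ℝ} {S : Set ℝ}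
    (h : ∀ s ∈ S, HasDerivAt τ 0 s) : volume (τ '' S) = 0 := by
  refine addHaar_image_eq_zero_of_det_fderivWithin_eq_zero volume (f' := fun _ => 0)
    (fun s hs => ?_) fun s _ => by simp
  have := (h s hs).hasFDerivAt.hasFDerivWithinAt (s := S)
  simpa using this

/-- A curve `X` which tends to the origin and is Lipschitz with respect to a time function `τ`
bounded by `T₀` can be reparametrized by time, and continued by zero from `T₀` on. -/
theorem exists_reparametrization {X : ℝ → ℝ × ℝ} {τ : ℝ → ℝ} {T₀ M : ℝ} (hτ : Continuous τ)
    (hτ0 : τ 0 = 0) (hT : Tendsto τ atTop (𝓝 T₀)) (hlt : ∀ s, 0 ≤ s → τ s < T₀)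
    (hX : Tendsto X atTop (𝓝 0)) (hM : 0 ≤ M)
    (hL : ∀ s s', 0 ≤ s → s ≤ s' → ‖X s' - X s‖ ≤ M * (τ s' - τ s))
    (hmono : ∀ s s', 0 ≤ s → s ≤ s' → τ s ≤ τ s') :
    ∃ x : ℝ → ℝ × ℝ, (∀ s, 0 ≤ s → x (τ s) = X s) ∧ (∀ t, T₀ ≤ t → x t = 0) ∧
      (∀ t, 0 ≤ t → t < T₀ → ∃ s, 0 ≤ s ∧ τ s = t) ∧
      ∀ t t', 0 ≤ t → 0 ≤ t' → ‖x t' - x t‖ ≤ M * |t' - t| := by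
  classical
  have hL' : ∀ s s', 0 ≤ s → 0 ≤ s' → ‖X s' - X s‖ ≤ M * |τ s' - τ s| := by
    intro s s' hs hs'
    rcases le_total s s' with h | h
    · rw [abs_of_nonneg (sub_nonneg.2 (hmono _ _ hs h))]
      exact hL _ _ hs h
    · rw [norm_sub_rev, abs_sub_comm, abs_of_nonneg (sub_nonneg.2 (hmono _ _ hs' h))]
      exact hL _ _ hs' h
  have hLT : ∀ s, 0 ≤ s → ‖X s‖ ≤ M * (T₀ - τ s) := by
    intro s hs
    have h1 : Tendsto (fun s' => ‖X s' - X s‖) atTop (𝓝 ‖(0 : ℝ × ℝ) - X s‖) :=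
      (hX.sub_const _).norm
    have h2 : Tendsto (fun s' => M * (τ s' - τ s)) atTop (𝓝 (M * (T₀ - τ s))) :=
      (hT.sub_const _).const_mul M
    have h3 := le_of_tendsto_of_tendsto h1 h2
      ((eventually_ge_atTop s).mono fun s' hs' => hL s s' hs hs')
    simpa using h3
  have hex : ∀ t, 0 ≤ t → t < T₀ → ∃ s, 0 ≤ s ∧ τ s = t := by
    intro t ht0 ht
    obtain ⟨N, hN0, hN⟩ := ((eventually_ge_atTop 0).and (hT.eventually (lt_mem_nhds ht))).exists
    obtain ⟨s, hs, hst⟩ := intermediate_value_Icc hN0 hτ.continuousOn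
      (show t ∈ Icc (τ 0) (τ N) from ⟨hτ0.trans_le ht0, hN.le⟩)
    exact ⟨s, hs.1, hst⟩
  let x : ℝ → ℝ × ℝ := fun t => if h : ∃ s, 0 ≤ s ∧ τ s = t then X h.choose else 0
  have hxτ : ∀ s, 0 ≤ s → x (τ s) = X s := by
    intro s hs
    have h : ∃ s', 0 ≤ s' ∧ τ s' = τ s := ⟨s, hs, rfl⟩
    have h1 := hL' s h.choose hs h.choose_spec.1
    rw [h.choose_spec.2, sub_self, abs_zero, mul_zero] at h1
    have h2 : x (τ s) = X h.choose := dif_pos h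
    rw [h2]
    exact sub_eq_zero.1 (norm_le_zero_iff.1 h1)
  have hxT : ∀ t, T₀ ≤ t → x t = 0 := fun t ht =>
    dif_neg fun ⟨s, hs, hst⟩ => absurd (hlt s hs) (not_lt.2 (hst ▸ ht))
  refine ⟨x, hxτ, hxT, hex, ?_⟩
  have key : ∀ t t', 0 ≤ t → t ≤ t' → ‖x t' - x t‖ ≤ M * (t' - t) := by
    intro t t' ht htt'
    rcases lt_or_ge t T₀ with h1 | h1
    · obtain ⟨s, hs, rfl⟩ := hex t ht h1
      rcases lt_or_ge t' T₀ with h2 | h2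
      · obtain ⟨s', hs', rfl⟩ := hex t' (ht.trans htt') h2
        rw [hxτ s hs, hxτ s' hs', ← abs_of_nonneg (sub_nonneg.2 htt')]
        exact hL' s s' hs hs'
      · rw [hxτ s hs, hxT t' h2, zero_sub, norm_neg]
        exact (hLT s hs).trans (by gcongr)
    · rw [hxT t h1, hxT t' (h1.trans htt'), sub_self, norm_zero]
      exact mul_nonneg hM (sub_nonneg.2 htt')
  intro t t' ht ht'
  rcases le_total t t' with h | h
  · rw [abs_of_nonneg (sub_nonneg.2 h)]
    exact key _ _ ht h
  · rw [norm_sub_rev, abs_sub_comm, abs_of_nonneg (sub_nonneg.2 h)]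
    exact key _ _ ht' h

/-- Derivative of a reparametrized curve, at a regular point of the time function. -/
theorem hasDerivAt_of_reparametrization {E : Type*} [NormedAddCommGroup E] [NormedSpace ℝ E]
    {x X : ℝ → E} {τ : ℝ → ℝ} {τ' s : ℝ} {X' : E} (hs : 0 < s) (hτ : HasStrictDerivAt τ τ' s)
    (hτ' : τ' ≠ 0) (hX : HasDerivAt X X' s) (hx : ∀ s, 0 ≤ s → x (τ s) = X s) :
    HasDerivAt x (τ'⁻¹ • X') (τ s) := by
  set ψ := hτ.localInverse τ τ' s hτ' with hψ
  have hψd : HasDerivAt ψ τ'⁻¹ (τ s) := (hτ.to_localInverse hτ').hasDerivAt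
  have hψs : ψ (τ s) = s := by
    have := (hτ.hasStrictFDerivAt_equiv hτ').localInverse_apply_image
    exact this
  have hr : ∀ᶠ t in 𝓝 (τ s), τ (ψ t) = t :=
    (hτ.hasStrictFDerivAt_equiv hτ').eventually_right_inverse
  have hpos : ∀ᶠ t in 𝓝 (τ s), 0 < ψ t :=
    hψd.continuousAt.eventually (lt_mem_nhds (by rwa [hψs]))
  have h1 : HasDerivAt (X ∘ ψ) (τ'⁻¹ • X') (τ s) := by
    refine HasDerivAt.scomp (τ s) ?_ hψd
    rwa [hψs]
  refine h1.congr_of_eventuallyEq ?_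
  filter_upwards [hr, hpos] with t ht htp
  rw [Function.comp_apply, ← hx _ htp.le, ht]

variable {Φ Ψ g h h' : ℝ → ℝ} {D : ℝ} {k : Params}

theorem isSignal_zero : IsSignal 0 fun _ => 0 where
  contDiff := contDiffOn_const
  lipschitz s t _ _ := by simp

theorem settlingTime_le_globalConvergenceTime {L : ℝ} {f : ℝ → ℝ} {x : ℝ → ℝ × ℝ}
    (hf : IsSignal L f) (hx : IsErrorSolution Φ k f x) :
    settlingTime x ≤ globalConvergenceTime Φ k L := by
  refine le_trans ?_ (le_iSup _ (x 0))
  refine le_trans ?_ (le_iSup₂ (f := fun f (_ : IsSignal L f) => convergenceTime Φ k (x 0) f) f hf)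
  exact le_iSup_of_le x (le_iSup_of_le hx (le_iSup_of_le rfl le_rfl))

theorem ofReal_le_settlingTime {x : ℝ → ℝ × ℝ} {T₀ : ℝ}
    (hx : ∀ t, 0 ≤ t → t < T₀ → x t ≠ 0) : ENNReal.ofReal T₀ ≤ settlingTime x := by
  refine le_sInf ?_
  rintro _ ⟨t, ht, hz, rfl⟩
  refine ENNReal.ofReal_le_ofReal (not_lt.1 fun hlt => hx t ht hlt (hz t le_rfl))

/-- Without a signal, the differentiator has a Filippov solution through every state, which is
obtained from the linear flow by a change of time and settles exactly at the time given by the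
settling integral. Hence this integral is bounded by the global convergence time. -/
theorem settlingIntegral_le_of_globalConvergenceTime_le (hΦ : IsDGF Φ) (hk : k.Pos)
    (H : IsImpulseResponse k.k₁ (2 * k.k₂) h h') (G : IsInverseDGF Φ Ψ g D)
    (hI : 2 * D * ∫ s in Ioi 0, |h s| ≤ 1) {T : ℝ} (hT : 0 ≤ T)
    (hb : globalConvergenceTime Φ k 0 ≤ ENNReal.ofReal T) (p q : ℝ) :
    settlingIntegral g h h' p q ≤ k.k₃ * T := by
  have hk₁ := hk.k₁_pos
  have hk₂ := hk.k₂_pos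
  have hk₃ := hk.k₃_pos
  have hb2 : 0 < 2 * k.k₂ := mul_pos two_pos hk₂
  by_cases hpq : p = 0 ∧ q = 0
  · rw [hpq.1, hpq.2, settlingIntegral_zero G]
    positivity
  set y : ℝ → ℝ := fun s => p * h' s + q * h s with hy
  set w : ℝ → ℝ := fun s => -(2 * k.k₂) * p * h s + q * (h' s + k.k₁ * h s) with hw
  have F : IsLinearFlow k.k₁ (2 * k.k₂) y w := H.isLinearFlow p q
  have hy0 : y 0 = p := by simp [hy, H.zero, H.zero']
  have hw0 : w 0 = q := by simp [hw, H.zero, H.zero']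
  have hne : ∀ s, ¬(y s = 0 ∧ w s = 0) := fun s hs => by
    have := H.flow_eq_zero F hs.1 hs.2 0
    rw [hy0, hw0] at this
    exact hpq this
  have hgy : Continuous fun s => g (y s) := G.continuous.comp F.continuous_fst
  have hΨ0 : Ψ 0 = 0 := by
    have := G.left_inv 0
    rwa [hΦ.zero] at this
  have hyt : Tendsto y atTop (𝓝 0) := by
    simpa using ((H.tendsto' hk₁ hb2).const_mul p).add ((H.tendsto hk₁ hb2).const_mul q)
  have hwt : Tendsto w atTop (𝓝 0) := by
    simpa [hw] using ((H.tendsto hk₁ hb2).const_mul (-(2 * k.k₂) * p)).add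
      (((H.tendsto' hk₁ hb2).add ((H.tendsto hk₁ hb2).const_mul k.k₁)).const_mul q)
  have hbdd : ∀ {u : ℝ → ℝ}, Continuous u → Tendsto u atTop (𝓝 0) →
      ∃ R, ∀ s, 0 ≤ s → |u s| ≤ R := by
    intro u hu hut
    obtain ⟨N, hN⟩ := eventually_atTop.1
      ((tendsto_order.1 hut.abs).2 1 (by simp))
    obtain ⟨R, hR⟩ := isCompact_Icc.exists_bound_of_continuousOn (s := Icc 0 N) hu.continuousOn
    refine ⟨max R 1, fun s hs => ?_⟩
    rcases le_total s N with h | h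
    · exact (hR s ⟨hs, h⟩).trans (le_max_left _ _)
    · exact (hN s h).le.trans (le_max_right _ _)
  obtain ⟨R, hR⟩ := hbdd F.continuous_fst hyt
  obtain ⟨R', hR'⟩ := hbdd F.continuous_snd hwt
  have hR0 : 0 ≤ R := (abs_nonneg _).trans (hR 0 le_rfl)
  have hR0' : 0 ≤ R' := (abs_nonneg _).trans (hR' 0 le_rfl)
  obtain ⟨c, hc, hlow⟩ := G.exists_lower R
  -- The physical time, and the physical error, along the linear trajectory.
  set τ : ℝ → ℝ := fun s => (∫ σ in (0 : ℝ)..s, g (y σ)) / k.k₃ with hτ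
  set X : ℝ → ℝ × ℝ := fun s => (Ψ (y s) / k.k₃ ^ 2, w s / k.k₃) with hX
  set T₀ := settlingIntegral g h h' p q / k.k₃ with hT₀
  have hτd : ∀ s, HasStrictDerivAt τ (g (y s) / k.k₃) s := fun s => by
    have h1 := (hgy.integral_hasStrictDerivAt 0 s).mul_const k.k₃⁻¹
    simpa only [hτ, div_eq_mul_inv] using h1
  have hτc : Continuous τ := continuous_iff_continuousAt.2 fun s => (hτd s).hasDerivAt.continuousAt
  have hτ0 : τ 0 = 0 := by simp [hτ]
  have hτV : ∀ s, τ s = T₀ - settlingIntegral g h h' (y s) (w s) / k.k₃ := by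
    intro s
    have := settlingIntegral_flow H hk₁ hb2 G F s
    rw [hy0, hw0] at this
    rw [this, hT₀, hτ]
    ring
  have hτt : Tendsto τ atTop (𝓝 T₀) := by
    have h1 := ((continuous_settlingIntegral H hk₁ hb2 G hI).tendsto (0, 0)).comp
      (hyt.prodMk_nhds hwt)
    have h2 : Tendsto (fun s => T₀ - settlingIntegral g h h' (y s) (w s) / k.k₃) atTop
        (𝓝 (T₀ - settlingIntegral g h h' 0 0 / k.k₃)) := (h1.div_const k.k₃).const_sub T₀
    rw [settlingIntegral_zero G, zero_div, sub_zero] at h2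
    exact h2.congr fun s => (hτV s).symm
  have hτm : Monotone τ := by
    refine monotone_of_deriv_nonneg (fun s => (hτd s).hasDerivAt.differentiableAt) fun s => ?_
    rw [(hτd s).hasDerivAt.deriv]
    exact div_nonneg (G.nonneg _) hk₃.le
  have hXd : ∀ s, HasDerivAt X
      (g (y s) * (-k.k₁ * y s + w s) / k.k₃ ^ 2, -(2 * k.k₂) * y s / k.k₃) s := fun s =>
    (((G.hasDerivAt (y s)).comp s (F.fst s)).div_const _).prodMk ((F.snd s).div_const _)
  have hΨc : Continuous Ψ := continuous_iff_continuousAt.2 fun z => (G.hasDerivAt z).continuousAt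
  have hXt : Tendsto X atTop (𝓝 0) := by
    have h1 := ((hΨc.tendsto 0).comp hyt).div_const (k.k₃ ^ 2)
    have h2 := h1.prodMk_nhds (hwt.div_const k.k₃)
    rw [hΨ0, zero_div, zero_div] at h2
    exact h2
  have hXne : ∀ s, X s ≠ 0 := by
    intro s h0
    have h1 : Ψ (y s) / k.k₃ ^ 2 = 0 := congrArg Prod.fst h0
    have h2 : w s / k.k₃ = 0 := congrArg Prod.snd h0
    rw [div_eq_zero_iff, or_iff_left (by positivity)] at h1 h2
    refine hne s ⟨?_, h2⟩
    rw [← G.right_inv (y s), h1, hΦ.zero]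
  -- `g` is bounded below by a multiple of `|y|`, so the speed of `X` is bounded in physical time.
  set M := (k.k₁ * R + R') / k.k₃ + 2 * k.k₂ / c with hM
  have hM0 : 0 ≤ M := by positivity
  have hXL : ∀ s s', 0 ≤ s → s ≤ s' → ‖X s' - X s‖ ≤ M * (τ s' - τ s) := by
    intro s s' hs hss'
    refine image_norm_le_of_norm_deriv_right_le_deriv_boundary (a := s) (b := s')
      (f := fun r => X r - X s) (B := fun r => M * (τ r - τ s))
      (B' := fun r => M * (g (y r) / k.k₃))
      (fun r _ => ((hXd r).sub_const _).continuousAt.continuousWithinAt)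
      (fun r _ => ((hXd r).sub_const _).hasDerivWithinAt) (by simp)
      (fun r => ((hτd r).hasDerivAt.sub_const _).const_mul M) (fun r hr => ?_) ⟨hss', le_rfl⟩
    have hr0 : 0 ≤ r := hs.trans hr.1
    have hgn := G.nonneg (y r)
    rw [Prod.norm_def]
    refine max_le ?_ ?_
    · rw [Real.norm_eq_abs, abs_div, abs_mul, abs_of_nonneg hgn,
        abs_of_pos (by positivity : 0 < k.k₃ ^ 2)]
      have h1 : |-k.k₁ * y r + w r| ≤ k.k₁ * R + R' := by
        refine (abs_add_le _ _).trans ?_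
        rw [abs_mul, abs_neg, abs_of_pos hk₁]
        have := hR r hr0
        have := hR' r hr0
        gcongr
      calc g (y r) * |-k.k₁ * y r + w r| / k.k₃ ^ 2
          ≤ g (y r) * (k.k₁ * R + R') / k.k₃ ^ 2 := by gcongr
        _ = (k.k₁ * R + R') / k.k₃ * (g (y r) / k.k₃) := by field_simp
        _ ≤ M * (g (y r) / k.k₃) := by
            refine mul_le_mul_of_nonneg_right ?_ (by positivity)
            rw [hM]
            have : 0 ≤ 2 * k.k₂ / c := by positivity
            linarith
    · rw [Real.norm_eq_abs, abs_div, abs_mul, abs_neg, abs_of_pos hb2, abs_of_pos hk₃]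
      have h1 := hlow (y r) (hR r hr0)
      calc 2 * k.k₂ * |y r| / k.k₃ = 2 * k.k₂ / c * (c * |y r| / k.k₃) := by field_simp
        _ ≤ 2 * k.k₂ / c * (g (y r) / k.k₃) := by gcongr
        _ ≤ M * (g (y r) / k.k₃) := by
            refine mul_le_mul_of_nonneg_right ?_ (by positivity)
            rw [hM]
            have : 0 ≤ (k.k₁ * R + R') / k.k₃ := by positivity
            linarith
  have hτle : ∀ s, τ s ≤ T₀ := fun s => by
    rw [hτV]
    have : 0 ≤ settlingIntegral g h h' (y s) (w s) / k.k₃ :=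
      div_nonneg (settlingIntegral_nonneg G _ _) hk₃.le
    linarith
  have hτlt : ∀ s, 0 ≤ s → τ s < T₀ := by
    intro s hs
    refine lt_of_le_of_ne (hτle s) fun heq => hXne s ?_
    have hconst : ∀ s', s ≤ s' → X s' = X s := by
      intro s' hss'
      have h1 := hXL s s' hs hss'
      rw [le_antisymm (hτle s') (heq ▸ hτm hss'), heq, sub_self, mul_zero] at h1
      exact sub_eq_zero.1 (norm_le_zero_iff.1 h1)
    refine tendsto_nhds_unique ?_ hXt
    exact tendsto_const_nhds.congr'
      ((eventually_ge_atTop s).mono fun s' hs' => (hconst s' hs').symm)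
  obtain ⟨x, hxτ, hxT, hex, hxL⟩ := exists_reparametrization hτc hτ0 hτt hτlt hXt hM0 hXL
    fun s s' _ hss' => hτm hss'
  have hsol : IsErrorSolution Φ k (fun _ => 0) x := by
    refine ⟨fun b hb => ?_, ?_⟩
    · have : LipschitzOnWith (Real.toNNReal M) x (uIcc 0 b) := by
        refine LipschitzOnWith.of_dist_le_mul fun t ht t' ht' => ?_
        rw [uIcc_of_le hb] at ht ht'
        rw [Real.coe_toNNReal _ hM0, dist_eq_norm, Real.dist_eq]
        exact hxL _ _ ht'.1 ht.1
      exact this.absolutelyContinuousOnInterval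
    · rw [ae_restrict_iff' measurableSet_Ici]
      have hnull : volume (τ '' {s | y s = 0}) = 0 := by
        refine volume_image_eq_zero_of_hasDerivAt_zero fun s hs => ?_
        have h1 := (hτd s).hasDerivAt
        rw [mem_ofPred_eq] at hs
        rwa [hs, G.zero, zero_div] at h1
      have hz : ∀ r : ℝ, ∀ᵐ t : ℝ, t ≠ r := fun r => by simp [ae_iff]
      filter_upwards [measure_eq_zero_iff_ae_notMem.1 hnull, hz 0, hz T₀] with t ht ht0 htT htI
      have htI' : 0 ≤ t := htI
      rcases lt_or_gt_of_ne htT with hlt | hgt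
      · obtain ⟨s, hs, rfl⟩ := hex t htI' hlt
        have hs0 : 0 < s := lt_of_le_of_ne hs fun h => ht0 (h ▸ hτ0)
        have hys : y s ≠ 0 := fun h0 => ht ⟨s, h0, rfl⟩
        have hg := G.pos _ hys
        have hX1 : (X s).1 ≠ 0 := by
          simp only [hX]
          refine div_ne_zero (fun h0 => hys ?_) (by positivity)
          rw [← G.right_inv (y s), h0, hΦ.zero]
        refine ⟨errorField Φ k (fun _ => 0) (τ s) (X s), ?_, ?_⟩
        · rw [hxτ s hs]
          exact mem_filippov_of_continuousAt (hΦ.continuousAt_errorField hk₃.ne' _ _ hX1)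
        · have h1 := hasDerivAt_of_reparametrization hs0 (hτd s) (div_pos hg hk₃).ne' (hXd s) hxτ
          refine h1.congr_deriv ?_
          have e1 : k.k₃ ^ 2 * (X s).1 = Ψ (y s) := by simp only [hX]; field_simp
          have e2 : secondDeriv (fun _ => 0) (τ s) = 0 := by simp [secondDeriv]
          simp only [errorField, nu₁, nu₂, e1, e2, G.right_inv, G.inv_deriv _ hys]
          simp only [hX, Prod.smul_mk, smul_eq_mul, Prod.mk.injEq]
          constructor <;> field_simp
          ring
      · refine ⟨0, ?_, ?_⟩
        · rw [hxT t hgt.le]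
          refine zero_mem_filippov_zero fun z => ?_
          have e2 : secondDeriv (fun _ => 0) t = 0 := by simp [secondDeriv]
          simp only [errorField, nu₁, nu₂, e2, Prod.fst_neg, Prod.snd_neg, mul_neg, hΦ.odd,
            hΦ.deriv_neg', Prod.neg_mk, Prod.mk.injEq]
          constructor <;> ring
        · refine (hasDerivAt_const t (0 : ℝ × ℝ)).congr_of_eventuallyEq ?_
          filter_upwards [Ioi_mem_nhds hgt] with r hr using hxT r (le_of_lt hr)
  have hle : ENNReal.ofReal T₀ ≤ ENNReal.ofReal T := by
    refine (ofReal_le_settlingTime (x := x) fun t ht htT => ?_).trans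
      ((settlingTime_le_globalConvergenceTime isSignal_zero hsol).trans hb)
    obtain ⟨s, hs, rfl⟩ := hex t ht htT
    rw [hxτ s hs]
    exact hXne s
  rw [ENNReal.ofReal_le_ofReal_iff hT, hT₀, div_le_iff₀ hk₃] at hle
  linarith

end

section

/-! ### Decay of the settling time along error trajectories -/

theorem IsSignal.abs_secondDeriv_le {L : ℝ} (hL : 0 ≤ L) {f : ℝ → ℝ} (hf : IsSignal L f) {t : ℝ}
    (ht : 0 < t) : |secondDeriv f t| ≤ L := by
  refine norm_deriv_le_of_lip' (f := derivWithin f (Ici 0)) hL ?_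
  filter_upwards [Ioi_mem_nhds ht] with s hs
  exact hf.lipschitz s t (le_of_lt hs) ht.le

theorem absolutelyContinuousOnInterval_of_dist_le {X Y Z : Type*} [PseudoMetricSpace X]
    [PseudoMetricSpace Y] [PseudoMetricSpace Z] {u : ℝ → X} {f : ℝ → Y} {f' : ℝ → Z}
    {a b K K' : ℝ} (hf : AbsolutelyContinuousOnInterval f a b)
    (hf' : AbsolutelyContinuousOnInterval f' a b)
    (h : ∀ s ∈ uIcc a b, ∀ t ∈ uIcc a b,
      dist (u s) (u t) ≤ K * dist (f s) (f t) + K' * dist (f' s) (f' t)) :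
    AbsolutelyContinuousOnInterval u a b := by
  unfold AbsolutelyContinuousOnInterval at hf hf' ⊢
  refine squeeze_zero' ?_ ?_ (by simpa using (hf.const_mul K).add (hf'.const_mul K'))
  · exact Eventually.of_forall fun _ => Finset.sum_nonneg fun _ _ => dist_nonneg
  · rw [eventually_inf_principal]
    filter_upwards with E hE
    rw [Finset.mul_sum, Finset.mul_sum, ← Finset.sum_add_distrib]
    refine Finset.sum_le_sum fun i hi => ?_
    exact h _ (hE.1 i hi).1 _ (hE.1 i hi).2

theorem hasDerivAt_fst_comp {x : ℝ → ℝ × ℝ} {w : ℝ × ℝ} {t : ℝ} (hx : HasDerivAt x w t) :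
    HasDerivAt (fun s => (x s).1) w.1 t :=
  (ContinuousLinearMap.fst ℝ ℝ ℝ).hasFDerivAt.comp_hasDerivAt t hx

theorem hasDerivAt_snd_comp {x : ℝ → ℝ × ℝ} {w : ℝ × ℝ} {t : ℝ} (hx : HasDerivAt x w t) :
    HasDerivAt (fun s => (x s).2) w.2 t :=
  (ContinuousLinearMap.snd ℝ ℝ ℝ).hasFDerivAt.comp_hasDerivAt t hx

/-- A decay inequality up to a fixed right end point persists in the limit at the left end
point. -/
theorem le_sub_mul_of_forall_Ioc {W : ℝ → ℝ} {c t σ : ℝ} (htσ : t < σ)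
    (hW : ContinuousWithinAt W (Ioi t) t)
    (h : ∀ s ∈ Ioc t σ, W σ ≤ W s - c * (σ - s)) : W σ ≤ W t - c * (σ - t) := by
  have h1 : Tendsto (fun s => W s - c * (σ - s)) (𝓝[>] t) (𝓝 (W t - c * (σ - t))) := by
    refine Tendsto.sub hW ?_
    exact (Continuous.tendsto (by fun_prop : Continuous fun s : ℝ => c * (σ - s)) t).mono_left
      nhdsWithin_le_nhds
  refine ge_of_tendsto h1 ?_
  filter_upwards [Ioc_mem_nhdsGT htσ] with s hs using h s hs

/-- The parameters `k` arise from `k'` by the tuning rule for the first two parameters; the third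
one is only required to be positive. -/
structure IsTuned (k' k : Params) (γ : ℝ) : Prop where
  pos : k'.Pos
  γ_pos : 0 < γ
  k₁_eq : k.k₁ = k'.k₁ * √γ
  k₂_eq : k.k₂ = k'.k₂ * γ
  k₃_pos : 0 < k.k₃

/-- The settling integral of the normalized linear system, as a function of the error of the
differentiator with parameters `k`. -/
def lyapunov (Φ g h h' : ℝ → ℝ) (k : Params) (γ : ℝ) (x : ℝ × ℝ) : ℝ :=
  settlingIntegral g h h' (Φ (k.k₃ ^ 2 * x.1)) (k.k₃ / √γ * x.2)

variable {Φ Ψ g h h' : ℝ → ℝ} {D L γ : ℝ} {k k' : Params} {f : ℝ → ℝ} {x : ℝ → ℝ × ℝ}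

theorem IsErrorSolution.continuousOn (hx : IsErrorSolution Φ k f x) : ContinuousOn x (Ici 0) := by
  intro t ht
  have h1 := (hx.locallyAC (t + 1) (by linarith [mem_Ici.1 ht])).continuousOn
  rw [uIcc_of_le (by linarith [mem_Ici.1 ht])] at h1
  refine (h1 t ⟨ht, by linarith⟩).mono_of_mem_nhdsWithin ?_
  rw [← Ici_inter_Iic]
  exact inter_mem_nhdsWithin _ (Iic_mem_nhds (by linarith))

theorem IsErrorSolution.ac_fst (hx : IsErrorSolution Φ k f x) {b : ℝ} (hb : 0 ≤ b) :
    AbsolutelyContinuousOnInterval (fun t => (x t).1) 0 b :=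
  absolutelyContinuousOnInterval_of_dist_le (K := 1) (K' := 0) (hx.locallyAC b hb)
    (hx.locallyAC b hb) fun s _ t _ => by
      rw [one_mul, zero_mul, add_zero, Prod.dist_eq]; exact le_max_left _ _

theorem IsErrorSolution.ac_snd (hx : IsErrorSolution Φ k f x) {b : ℝ} (hb : 0 ≤ b) :
    AbsolutelyContinuousOnInterval (fun t => (x t).2) 0 b :=
  absolutelyContinuousOnInterval_of_dist_le (K := 1) (K' := 0) (hx.locallyAC b hb)
    (hx.locallyAC b hb) fun s _ t _ => by
      rw [one_mul, zero_mul, add_zero, Prod.dist_eq]; exact le_max_right _ _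

/-- The first error variable obeys the first equation in integrated form, also while it
vanishes. -/
theorem IsErrorSolution.fst_sub_eq_integral (hΦ : IsDGF Φ) (hx : IsErrorSolution Φ k f x)
    {t s : ℝ} (ht : 0 ≤ t) (hts : t ≤ s) :
    (x s).1 - (x t).1 = ∫ r in t..s, (-k.k₁ * nu₁ Φ k (x r).1 + (x r).2) := by
  have hac : AbsolutelyContinuousOnInterval (fun r => (x r).1) t s :=
    (hx.ac_fst (ht.trans hts)).mono (by
      rw [uIcc_of_le hts, uIcc_of_le (ht.trans hts)]; exact Icc_subset_Icc_left ht)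
  rw [← hac.integral_deriv_eq_sub]
  refine intervalIntegral.integral_congr_ae ?_
  filter_upwards [(ae_restrict_iff' measurableSet_Ici).1 hx.inclusion] with r hr hrm
  rw [uIoc_of_le hts] at hrm
  obtain ⟨w, hw, hd⟩ := hr (ht.trans hrm.1.le)
  rw [(hasDerivAt_fst_comp hd).deriv]
  exact fst_eq_of_mem_filippov (hΦ.continuous_errorField_fst k f r).continuousAt hw

/-- A nonzero error whose first component vanishes leaves the axis transversally, hence at
once. -/
theorem IsErrorSolution.exists_fst_ne_zero (hΦ : IsDGF Φ) (hx : IsErrorSolution Φ k f x) {t : ℝ}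
    (ht : 0 ≤ t) (h0 : x t ≠ 0) : ∃ η > 0, ∀ s ∈ Ioc t (t + η), (x s).1 ≠ 0 := by
  by_cases h1 : (x t).1 = 0
  · set u := (x t).2 with hu
    have hu0 : u ≠ 0 := fun h => h0 (Prod.ext h1 h)
    set F : ℝ → ℝ := fun r => -k.k₁ * nu₁ Φ k (x r).1 + (x r).2 with hF
    have hFc : ContinuousOn F (Ici 0) :=
      (hΦ.continuous_errorField_fst k (fun _ => 0) 0).comp_continuousOn hx.continuousOn
    have hFt : F t = u := by simp [hF, nu₁, h1, hΦ.zero, hu]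
    have hev : ∀ᶠ r in 𝓝[≥] t, 0 < F r * u := by
      have h2 : ContinuousWithinAt (fun r => F r * u) (Ici t) t :=
        ((hFc t ht).mono (Ici_subset_Ici.2 ht)).mul continuousWithinAt_const
      refine h2.eventually (lt_mem_nhds ?_)
      simp only [hFt]
      exact mul_self_pos.2 hu0
    obtain ⟨η, hη, hpos⟩ := mem_nhdsGE_iff_exists_Icc_subset.1 hev
    refine ⟨η - t, sub_pos.2 hη, fun s hs h3 => ?_⟩
    have h4 := hx.fst_sub_eq_integral hΦ ht hs.1.le
    rw [h3, h1, sub_self] at h4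
    have h5 : 0 < ∫ r in t..s, F r * u := by
      refine intervalIntegral.intervalIntegral_pos_of_pos_on ?_ ?_ hs.1
      · refine ContinuousOn.intervalIntegrable ?_
        rw [uIcc_of_le hs.1.le]
        exact (hFc.mono fun r hr => ht.trans hr.1).mul continuousOn_const
      · intro r hr
        exact hpos ⟨hr.1.le, hr.2.le.trans (by linarith [hs.2])⟩
    rw [intervalIntegral.integral_mul_const, ← h4, zero_mul] at h5
    exact lt_irrefl _ h5
  · have h2 : ∀ᶠ r in 𝓝[≥] t, (x r).1 ≠ 0 := by
      have : ContinuousWithinAt (fun r => (x r).1) (Ici t) t :=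
        ((hx.continuousOn t ht).mono (Ici_subset_Ici.2 ht)).fst
      exact this.eventually_ne h1
    obtain ⟨η, hη, hne⟩ := mem_nhdsGE_iff_exists_Icc_subset.1 h2
    refine ⟨η - t, sub_pos.2 hη, fun s hs => hne ⟨hs.1.le, ?_⟩⟩
    linarith [hs.2]

theorem continuous_lyapunov (hΦ : IsDGF Φ) (ht : IsTuned k' k γ)
    (H : IsImpulseResponse k'.k₁ (2 * k'.k₂) h h') (G : IsInverseDGF Φ Ψ g D)
    (hI : 2 * D * ∫ s in Ioi 0, |h s| ≤ 1) : Continuous (lyapunov Φ g h h' k γ) := by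
  have h1 := continuous_settlingIntegral H ht.pos.k₁_pos (mul_pos two_pos ht.pos.k₂_pos) G hI
  have h2 := hΦ.continuous
  have h3 : Continuous fun x : ℝ × ℝ => (Φ (k.k₃ ^ 2 * x.1), k.k₃ / √γ * x.2) := by fun_prop
  exact h1.comp h3

/-- While the first error variable does not vanish, the Lyapunov function is absolutely continuous
in time, and decays at the guaranteed rate. -/
theorem lyapunov_le_of_fst_ne_zero (hΦ : IsDGF Φ) (ht : IsTuned k' k γ)
    (H : IsImpulseResponse k'.k₁ (2 * k'.k₂) h h') (G : IsInverseDGF Φ Ψ g D)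
    (hI : 2 * D * ∫ s in Ioi 0, |h s| ≤ 1) (hL : 0 ≤ L) (hf : IsSignal L f)
    (hx : IsErrorSolution Φ k f x) {t s : ℝ} (ht0 : 0 ≤ t) (hts : t ≤ s)
    (hne : ∀ r ∈ Icc t s, (x r).1 ≠ 0) :
    lyapunov Φ g h h' k γ (x s) ≤ lyapunov Φ g h h' k γ (x t)
      - k.k₃ * √γ * (1 - L / γ) * (s - t) := by
  have ha := ht.pos.k₁_pos
  have hb : 0 < 2 * k'.k₂ := mul_pos two_pos ht.pos.k₂_pos
  have hk₃ := ht.k₃_pos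
  have hγ := ht.γ_pos
  have hr0 : 0 < √γ := Real.sqrt_pos.2 hγ
  have hr2 : √γ ^ 2 = γ := Real.sq_sqrt hγ.le
  set p : ℝ → ℝ := fun r => Φ (k.k₃ ^ 2 * (x r).1) with hp
  set q : ℝ → ℝ := fun r => k.k₃ / √γ * (x r).2 with hq
  have hsub : uIcc t s ⊆ uIcc 0 s := by
    rw [uIcc_of_le hts, uIcc_of_le (ht0.trans hts)]; exact Icc_subset_Icc_left ht0
  have hx1 := (hx.ac_fst (ht0.trans hts)).mono hsub
  have hx2 := (hx.ac_snd (ht0.trans hts)).mono hsub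
  -- The first component takes its values in a compact interval on which `Φ` is smooth.
  have hpac : AbsolutelyContinuousOnInterval p t s := by
    have himg := hx1.continuousOn.image_uIcc
    set A := sInf ((fun r => (x r).1) '' uIcc t s)
    set B := sSup ((fun r => (x r).1) '' uIcc t s)
    have hIcc : ∀ y ∈ uIcc A B, y ≠ 0 := by
      intro y hy
      rw [← himg] at hy
      obtain ⟨r, hr, rfl⟩ := hy
      rw [uIcc_of_le hts] at hr
      exact hne r hr
    have hcd : ContDiffOn ℝ 1 (fun y => Φ (k.k₃ ^ 2 * y)) (uIcc A B) := by
      refine hΦ.contDiff.comp (by fun_prop) fun y hy => ?_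
      exact mul_ne_zero (by positivity) (hIcc y hy)
    obtain ⟨K, hK⟩ := hcd.exists_lipschitzOnWith (by decide) (convex_uIcc _ _) isCompact_uIcc
    refine absolutelyContinuousOnInterval_of_dist_le (K := K) (K' := 0) hx1 hx1
      fun r hr r' hr' => ?_
    rw [zero_mul, add_zero]
    exact hK.dist_le_mul _ (himg ▸ mem_image_of_mem _ hr) _ (himg ▸ mem_image_of_mem _ hr')
  have hqac : AbsolutelyContinuousOnInterval q t s := hx2.const_mul _
  have hWac : AbsolutelyContinuousOnInterval (fun r => lyapunov Φ g h h' k γ (x r)) t s := by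
    refine absolutelyContinuousOnInterval_of_dist_le
      (K := 2 * D * ∫ s in Ioi 0, |h' s|) (K' := 1) hpac hqac fun r _ r' _ => ?_
    rw [one_mul]
    exact abs_settlingIntegral_sub_le H ha hb G hI _ _ _ _
  have hle : ∫ r in t..s, deriv (fun r => lyapunov Φ g h h' k γ (x r)) r
      ≤ ∫ r in t..s, -(k.k₃ * √γ * (1 - L / γ)) := by
    refine intervalIntegral.integral_mono_ae_restrict hts hWac.intervalIntegrable_deriv
      intervalIntegrable_const ?_
    refine (ae_restrict_iff' measurableSet_Icc).2 ?_
    have hz : ∀ᵐ r : ℝ, r ≠ 0 := by simp [ae_iff]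
    filter_upwards [(ae_restrict_iff' measurableSet_Ici).1 hx.inclusion,
      hWac.ae_differentiableAt, hz] with r hr hrd hr0' hrm
    have hrpos : 0 < r := lt_of_le_of_ne (ht0.trans hrm.1) hr0'.symm
    obtain ⟨w, hw, hd⟩ := hr hrpos.le
    have hc := hΦ.continuousAt_errorField hk₃.ne' f r (hne r hrm)
    have hw1 : w.1 = (errorField Φ k f r (x r)).1 :=
      fst_eq_of_mem_filippov hc.fst hw
    have hw2 : w.2 = (errorField Φ k f r (x r)).2 :=
      snd_eq_of_mem_filippov hc.snd hw
    have hd1 : HasDerivAt (fun r => (x r).1) w.1 r := hasDerivAt_fst_comp hd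
    have hd2 : HasDerivAt (fun r => (x r).2) w.2 r := hasDerivAt_snd_comp hd
    have hξ : k.k₃ ^ 2 * (x r).1 ≠ 0 := mul_ne_zero (by positivity) (hne r hrm)
    have hp0 : p r ≠ 0 := by
      intro h0
      apply hξ
      apply hΦ.strictMono.injective
      rw [hΦ.zero]
      exact h0
    have hg := G.pos _ hp0
    have hΦ' : deriv Φ (k.k₃ ^ 2 * (x r).1) = (g (p r))⁻¹ := by
      rw [← G.inv_deriv _ hp0, hp]
      simp only [G.left_inv]
    have hpd : HasDerivAt p (k.k₃ * √γ * (g (p r))⁻¹ * (-k'.k₁ * p r + q r)) r := by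
      have := HasDerivAt.comp r (hΦ.hasDerivAt hξ) (hd1.const_mul (k.k₃ ^ 2))
      refine this.congr_deriv ?_
      rw [hΦ', hw1]
      simp only [errorField, nu₁, ht.k₁_eq, hq, hp]
      field_simp
    have hqd : HasDerivAt q (k.k₃ * √γ * (g (p r))⁻¹ * (-(2 * k'.k₂) * p r)
        + k.k₃ * √γ * (secondDeriv f r / γ)) r := by
      refine (hd2.const_mul (k.k₃ / √γ)).congr_deriv ?_
      rw [hw2]
      simp only [errorField, nu₂, ht.k₂_eq, hΦ']
      have e : Φ (k.k₃ ^ 2 * (x r).1) = p r := rfl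
      rw [e]
      generalize √γ = ρ at *
      subst hr2
      field_simp
    refine deriv_settlingIntegral_le H ha hb G hI (mul_pos hk₃ hr0) hp0 hpd hqd ?_
      (hrd (by rw [uIcc_of_le hts]; exact hrm)).hasDerivAt
    rw [abs_div, abs_of_pos hγ]
    exact div_le_div_of_nonneg_right (hf.abs_secondDeriv_le hL hrpos) hγ.le
  rw [hWac.integral_deriv_eq_sub, intervalIntegral.integral_const, smul_eq_mul] at hle
  linarith

/-- The Lyapunov function decays at the guaranteed rate as long as the error is nonzero: the zeros
of the first error variable are crossed by continuity. -/
theorem lyapunov_le_of_ne_zero (hΦ : IsDGF Φ) (ht : IsTuned k' k γ)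
    (H : IsImpulseResponse k'.k₁ (2 * k'.k₂) h h') (G : IsInverseDGF Φ Ψ g D)
    (hI : 2 * D * ∫ s in Ioi 0, |h s| ≤ 1) (hL : 0 ≤ L) (hf : IsSignal L f)
    (hx : IsErrorSolution Φ k f x) {t s : ℝ} (ht0 : 0 ≤ t) (hts : t < s)
    (hne : ∀ r ∈ Ioc t s, x r ≠ 0) :
    lyapunov Φ g h h' k γ (x s) ≤ lyapunov Φ g h h' k γ (x t)
      - k.k₃ * √γ * (1 - L / γ) * (s - t) := by
  set W : ℝ → ℝ := fun r => lyapunov Φ g h h' k γ (x r) with hW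
  set c := k.k₃ * √γ * (1 - L / γ)
  have hWc : ContinuousOn W (Ici 0) :=
    (continuous_lyapunov hΦ ht H G hI).comp_continuousOn hx.continuousOn
  refine le_sub_mul_of_forall_Ioc (W := W) hts
    ((hWc t ht0).mono fun r hr => ht0.trans (le_of_lt hr)) fun t₁ ht₁ => ?_
  have ht₁0 : 0 ≤ t₁ := ht0.trans ht₁.1.le
  have hcl : IsClosed ({r | W r ≤ W t₁ - c * (r - t₁)} ∩ Icc t₁ s) := by
    have := isClosed_Icc.isClosed_le (hWc.mono fun r (hr : r ∈ Icc t₁ s) => ht₁0.trans hr.1)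
      (by fun_prop : Continuous fun r => W t₁ - c * (r - t₁)).continuousOn
    convert this using 1
    ext r
    simp only [mem_inter_iff, mem_ofPred_eq]
    tauto
  refine hcl.Icc_subset_of_forall_exists_gt (by simp) (fun r hr y hy => ?_) ⟨ht₁.2, le_rfl⟩
  have hr0 : 0 ≤ r := ht₁0.trans hr.2.1
  obtain ⟨η, hη, hηne⟩ := hx.exists_fst_ne_zero hΦ hr0
    (hne r ⟨ht₁.1.trans_le hr.2.1, hr.2.2.le⟩)
  have hlt : r < min (r + η) y := lt_min (by linarith) hy
  refine ⟨min (r + η) y, ?_, hlt, min_le_right _ _⟩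
  have h1 : W (min (r + η) y) ≤ W r - c * (min (r + η) y - r) := by
    refine le_sub_mul_of_forall_Ioc (W := W) hlt
      ((hWc r hr0).mono fun r' hr' => hr0.trans (le_of_lt hr')) fun r' hr' => ?_
    refine lyapunov_le_of_fst_ne_zero hΦ ht H G hI hL hf hx (hr0.trans hr'.1.le) hr'.2
      fun r'' hr'' => hηne _ ⟨hr'.1.trans_le hr''.1, hr''.2.trans (min_le_left _ _)⟩
  have h2 := hr.1
  simp only [mem_ofPred_eq] at h2 ⊢
  linarith

/-- Once the guaranteed decay would make the Lyapunov function negative, the error is zero; this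
includes that it cannot leave the origin again. -/
theorem eq_zero_of_lyapunov_lt (hΦ : IsDGF Φ) (ht : IsTuned k' k γ)
    (H : IsImpulseResponse k'.k₁ (2 * k'.k₂) h h') (G : IsInverseDGF Φ Ψ g D)
    (hI : 2 * D * ∫ s in Ioi 0, |h s| ≤ 1) (hL : 0 ≤ L) (hLγ : L < γ) (hf : IsSignal L f)
    (hx : IsErrorSolution Φ k f x) {σ : ℝ} (hσ : 0 < σ)
    (hlt : lyapunov Φ g h h' k γ (x 0) < k.k₃ * √γ * (1 - L / γ) * σ) : x σ = 0 := by
  by_contra h0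
  have hc : 0 < k.k₃ * √γ * (1 - L / γ) := by
    have h1 : L / γ < 1 := (div_lt_one ht.γ_pos).2 hLγ
    have h2 : 0 < √γ := Real.sqrt_pos.2 ht.γ_pos
    exact mul_pos (mul_pos ht.k₃_pos h2) (sub_pos.2 h1)
  have hnn : 0 ≤ lyapunov Φ g h h' k γ (x σ) := settlingIntegral_nonneg G _ _
  set Z := {r | r ∈ Icc 0 σ ∧ x r = 0} with hZ
  rcases Z.eq_empty_or_nonempty with hem | hne
  · have := lyapunov_le_of_ne_zero hΦ ht H G hI hL hf hx le_rfl hσ fun r hr h1 => by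
      have : r ∈ Z := ⟨⟨hr.1.le, hr.2⟩, h1⟩
      rw [hem] at this
      exact this
    rw [sub_zero] at this
    linarith
  · have hZc : IsCompact Z := by
      refine isCompact_Icc.of_isClosed_subset ?_ fun r hr => hr.1
      exact (hx.continuousOn.mono fun r (hr : r ∈ Icc 0 σ) => hr.1).preimage_isClosed_of_isClosed
        isClosed_Icc isClosed_singleton
    obtain ⟨m, hm, hmax⟩ := hZc.exists_isGreatest hne
    have hmσ : m < σ := lt_of_le_of_ne hm.1.2 fun h => h0 (h ▸ hm.2)
    have := lyapunov_le_of_ne_zero hΦ ht H G hI hL hf hx hm.1.1 hmσ fun r hr h1 =>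
      absurd (hmax ⟨⟨hm.1.1.trans hr.1.le, hr.2⟩, h1⟩) (not_le.2 hr.1)
    have hz : lyapunov Φ g h h' k γ (x m) = 0 := by
      rw [hm.2, lyapunov]
      simp [hΦ.zero, settlingIntegral_zero G]
    rw [hz] at this
    have := mul_pos hc (sub_pos.2 hmσ)
    linarith

end

/-! ### The tuning rule -/

/-- The tuning rule for the third parameter makes the guaranteed decay over the time `T` equal to
the bound `k₃' T'` on the settling integral. -/
theorem tuned_rate_mul {γ L T T' k₃' : ℝ} (hγ0 : 0 < γ) (hγ : L < γ) (hT : 0 < T) :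
    k₃' * √γ / (γ - L) * (T' / T) * √γ * (1 - L / γ) * T = k₃' * T' := by
  have hr0 : 0 < √γ := Real.sqrt_pos.2 hγ0
  have hr2 : √γ ^ 2 = γ := Real.sq_sqrt hγ0.le
  have hd : γ - L ≠ 0 := (sub_pos.2 hγ).ne'
  generalize √γ = ρ at *
  subst hr2
  field_simp

/-- A solution which vanishes at all times after `T` settles by the time `T`. -/
theorem settlingTime_le_of_forall_gt {x : ℝ → ℝ × ℝ} {T : ℝ} (hT : 0 ≤ T)
    (hx : ∀ t, T < t → x t = 0) : settlingTime x ≤ ENNReal.ofReal T := by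
  have h1 : Tendsto ENNReal.ofReal (𝓝[>] T) (𝓝 (ENNReal.ofReal T)) :=
    (ENNReal.continuous_ofReal.tendsto T).mono_left nhdsWithin_le_nhds
  refine ge_of_tendsto h1 ?_
  filter_upwards [self_mem_nhdsWithin] with t ht
  exact sInf_le ⟨t, hT.trans (le_of_lt ht), fun σ hσ => hx σ (lt_of_lt_of_le ht hσ), rfl⟩

end RobustDiff

end

theorem mainTheorem1
    (L T : ℝ) (hL : 0 ≤ L) (hT : 0 < T)
    (Φ : ℝ → ℝ) (hΦ : RobustDiff.IsAdmissible Φ)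
    (k' : RobustDiff.Params) (hk' : RobustDiff.IsNormalized Φ k')
    (T' : ℝ) (hT' : 0 < T')
    (hbound : RobustDiff.globalConvergenceTime Φ k' 0 ≤ ENNReal.ofReal T')
    (γ : ℝ) (hγ : L < γ)
    (k : RobustDiff.Params)
    (hk₁ : k.k₁ = k'.k₁ * √γ)
    (hk₂ : k.k₂ = k'.k₂ * γ)
    (hk₃ : k.k₃ = k'.k₃ * √γ / (γ - L) * (T' / T)) :
    RobustDiff.globalConvergenceTime Φ k L ≤ ENNReal.ofReal T := by
  obtain ⟨hpos, B, C, D, hA, hL1⟩ := hk'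
  have hγ0 : 0 < γ := hL.trans_lt hγ
  have hr0 : 0 < √γ := Real.sqrt_pos.2 hγ0
  have hd : 0 < γ - L := sub_pos.2 hγ
  obtain ⟨h, h', H, hI⟩ := RobustDiff.exists_impulseResponse hpos
    (lt_of_lt_of_le one_pos hA.one_le_D) hL1
  obtain ⟨Ψ, g, G⟩ := hA.exists_inverse
  have hk₃0 : 0 < k.k₃ := by
    have := hpos.k₃_pos
    rw [hk₃]
    positivity
  have ht : RobustDiff.IsTuned k' k γ := ⟨hpos, hγ0, hk₁, hk₂, hk₃0⟩
  refine iSup_le fun x₀ => iSup₂_le fun f hf => iSup_le fun x => iSup_le fun hx =>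
    iSup_le fun _ => ?_
  refine RobustDiff.settlingTime_le_of_forall_gt hT.le fun σ hσ => ?_
  refine RobustDiff.eq_zero_of_lyapunov_lt hA.isDGF ht H G hI hL hγ hf hx (hT.trans hσ) ?_
  have hrate : 0 < k.k₃ * √γ * (1 - L / γ) :=
    mul_pos (mul_pos hk₃0 hr0) (sub_pos.2 ((div_lt_one hγ0).2 hγ))
  calc RobustDiff.lyapunov Φ g h h' k γ (x 0) ≤ k'.k₃ * T' :=
        RobustDiff.settlingIntegral_le_of_globalConvergenceTime_le hA.isDGF hpos H G hI hT'.le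
          hbound _ _
    _ = k.k₃ * √γ * (1 - L / γ) * T := by
        rw [hk₃, RobustDiff.tuned_rate_mul hγ0 hγ hT]
    _ < k.k₃ * √γ * (1 - L / γ) * σ := mul_lt_mul_of_pos_left hσ hrate
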